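/- Fix an integer $n\ge 1$. Cells are pairs $(i,k)$ of integers $i,k\le n$ (column $i$, row $k$); columns are numbered decreasingly from left to right (column $n$ is the leftmost) and rows decreasingly from top to bottom (row $n$ is the top one). A finite set $R$ of cells is viewed as a table of strands: the strand labeled $a\le n$ starts at the left end of row $a$ and travels right and up; at a cell of $R$ the two strands passing through it cross, and at every other cell the strand entering from the left turns up and the strand entering from below turns right. $R$ is an rc-graph if no two strands cross twice. A cell $(i,k)\notin R$ is an open space of $R$ if the strand entering it from the left has a positive label and the strand entering it from below has a nonpositive label. Insertion of $k$ ($1\le k\le n$) into an rc-graph $R$: put $k_1=k$, let $i_1$ be the smallest number such that $(i_1,k_1)$ is an open space, and add $(i_1,k_1)$ to $R$. As long as the current table is not an rc-graph, the two strands crossing at the last inserted cell $(i_j,k_j)$ cross also at a cell $(\ell_{j+1},k_{j+1})$ with $k_{j+1}>k_j$; remove that cell, let $i_{j+1}$ be the smallest number $>\ell_{j+1}$ such that $(i_{j+1},k_{j+1})$ is an open space of the current table, and add $(i_{j+1},k_{j+1})$. Stop when the table is an rc-graph, which is denoted $R\leftarrow k$; put $k_{j+1}=n+1$ if $(i_j,k_j)$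 was the last inserted cell. The left (right) path of the insertion consists, for each $j$, of the piece of strand which leaves the crossing $(i_j,k_j)$ through its top side (right side), in the table just after $(i_j,k_j)$ was inserted, followed up to row $k_{j+1}$ (up to the top of the table when $k_{j+1}=n+1$). One path is weakly to the left of another if, for every $m$ such that both paths go up from row $m-1$ to row $m$ ($m=n+1$ being the top of the table), the first does so in the same column as the second or in a column to the left of it. **Lemma.** Let $R$ be an rc-graph in which no two strands with nonpositive labels cross, and let $x,y\in\{1,\dots,n\}$. Then the insertion of $x$ into $R$ and the subsequent insertion of $y$ into $R\leftarrow x$ can be carried out and stop, and: 1. if $x\le y$, the right path of the insertion of $x$ into $R$ is weakly to the left of the left path of the insertion of $y$ into $R\leftarrow x$; 2. if $x>y$, the left path of the insertion of $x$ into $R$ is weakly to the right of the right path of the insertion of $y$ into $R\leftarrow x$ (that is, the latter is weakly to the left of the former). -/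

import Mathlib

/-!
Rc-graphs, the insertion algorithm and its left and right paths.

A cell is a pair `(i, k)`, column `i`, row `k`, with `i ≤ n` and `k ≤ n`. Columns are numbered
decreasingly from left to right (column `n` is the leftmost one) and rows decreasingly from top to
bottom (row `n` is the top one). A table of strands is a finite set `R` of cells, the cells at
which the two strands passing through the cell cross. In every other cell the strand entering from
the left turns up, and the strand entering from below turns to the right.
-/

namespace RCGraph

/-- A unit edge of the grid: `h i k` is the left side of the cell `(i, k)` and `v i k` is the
bottom side of the cell `(i, k)`. So the right side of `(i, k)` is `h (i - 1) k`, and its top side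
is `v i (k + 1)`. -/
inductive Edge
  | h (i k : ℤ)
  | v (i k : ℤ)

/-- The edge by which a strand leaves the cell that it enters through the given edge. -/
def next (R : Finset (ℤ × ℤ)) : Edge → Edge
  | .h i k => if (i, k) ∈ R then .h (i - 1) k else .v i (k + 1)
  | .v i k => if (i, k) ∈ R then .v i (k + 1) else .h (i - 1) k

/-- Following in the table `R` the strand through the edge `e` (to the right and up), one passes
through the edge `e'`. -/
def Follows (R : Finset (ℤ × ℤ)) (e e' : Edge) : Prop :=
  ∃ t : ℕ, (next R)^[t] e = e'

/-- The strand labeled `a`, which is the one starting at the left end of row `a`, passes through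
the edge `e`. -/
def OnStrand (n : ℤ) (R : Finset (ℤ × ℤ)) (a : ℤ) (e : Edge) : Prop :=
  Follows R (.h n a) e

/-- In the cell `c`, the strand `a` enters from the left and the strand `b` enters from below. -/
def Meet (n : ℤ) (R : Finset (ℤ × ℤ)) (a b : ℤ) (c : ℤ × ℤ) : Prop :=
  OnStrand n R a (.h c.1 c.2) ∧ OnStrand n R b (.v c.1 c.2)

/-- The strands `a` and `b` intersect at the cell `c`. -/
def CrossAt (n : ℤ) (R : Finset (ℤ × ℤ)) (a b : ℤ) (c : ℤ × ℤ) : Prop :=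
  c ∈ R ∧ (Meet n R a b c ∨ Meet n R b a c)

/-- `R` is an rc-graph: no two strands intersect twice. -/
def IsRCGraph (n : ℤ) (R : Finset (ℤ × ℤ)) : Prop :=
  (∀ c ∈ R, c.1 ≤ n ∧ c.2 ≤ n) ∧
  ∀ a b : ℤ, a ≠ b → ∀ c c' : ℤ × ℤ, CrossAt n R a b c → CrossAt n R a b c' → c = c'

/-- No two nonpositive strands of `R` intersect. -/
def NoNonposCrossing (n : ℤ) (R : Finset (ℤ × ℤ)) : Prop :=
  ∀ a b : ℤ, a ≠ b → a ≤ 0 → b ≤ 0 → ∀ c : ℤ × ℤ, ¬ CrossAt n R a b c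

/-- `(i, k)` is an open space of `R`: the strands do not intersect there, the top strand (the one
entering from the left) is positive and the bottom strand (the one entering from below) is
nonpositive. -/
def IsOpenSpace (n : ℤ) (R : Finset (ℤ × ℤ)) (i k : ℤ) : Prop :=
  (i, k) ∉ R ∧ ∃ a b : ℤ, 0 < a ∧ b ≤ 0 ∧ Meet n R a b (i, k)

/-- The situation right after an intersection was inserted: `graph` is the current table, and
`(col, row)` is the intersection just inserted. -/
structure Stage where
  graph : Finset (ℤ × ℤ)
  col : ℤ
  row : ℤ

/-- The first step of the insertion of `k` into `R`: insert the intersection `(i₁, k)`, where `i₁`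
is the smallest number such that `(i₁, k)` is an open space. -/
def FirstStage (n : ℤ) (R : Finset (ℤ × ℤ)) (k : ℤ) (S : Stage) : Prop :=
  S.row = k ∧ IsLeast {i : ℤ | IsOpenSpace n R i k} S.col ∧
  S.graph = insert (S.col, S.row) R

/-- The step from `S` to `S'`: the strands `a`, `b` which intersect at the place just inserted also
intersect at a place `(l, k')` in a higher row `k'`; this intersection is removed, and then the
intersection `(i', k')` is inserted, where `i'` is the smallest number greater than `l` such that
`(i', k')` is an open space. -/
def NextStage (n : ℤ) (S S' : Stage) : Prop :=
  ∃ a b l : ℤ,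
    CrossAt n S.graph a b (S.col, S.row) ∧ CrossAt n S.graph a b (l, S'.row) ∧
    S.row < S'.row ∧
    IsLeast {i : ℤ | l < i ∧ IsOpenSpace n (S.graph.erase (l, S'.row)) i S'.row} S'.col ∧
    S'.graph = insert (S'.col, S'.row) (S.graph.erase (l, S'.row))

/-- `Run n S L R'`: the algorithm, continued from the stage `S`, passes through the list `L` of
stages (which starts with `S`), and stops with the result `R'`. It stops as soon as the table is an
rc-graph, and not earlier. -/
inductive Run (n : ℤ) : Stage → List Stage → Finset (ℤ × ℤ) → Prop
  | halt (S : Stage) (hS : IsRCGraph n S.graph) : Run n S [S] S.graph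
  | step (S S' : Stage) (L : List Stage) (R' : Finset (ℤ × ℤ)) (hS : ¬ IsRCGraph n S.graph)
      (hstep : NextStage n S S') (hrun : Run n S' L R') : Run n S (S :: L) R'

/-- The algorithm inserting `k` into `R` passes through the list `L` of stages and stops with the
result `R' = R ← k`. -/
def Inserts (n : ℤ) (R : Finset (ℤ × ℤ)) (k : ℤ) (L : List Stage) (R' : Finset (ℤ × ℤ)) : Prop :=
  ∃ S : Stage, FirstStage n R k S ∧ Run n S L R'

/-- The row in which the stages of the list `L` begin; `n + 1` if there are none. -/
def startRow (n : ℤ) : List Stage → ℤ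
  | [] => n + 1
  | S :: _ => S.row

/-- The left path of an insertion: `LeftPath n L c m` says that the left path goes up from row
`m - 1` to row `m` in column `c` (for `m = n + 1`: that it ends at the top of column `c`).
It consists of pieces of strands, one for each stage: the piece belonging to an inserted
intersection `(i, k)` leaves this cell through its top side and goes up to the row of the next
intersection, or to the top of the table (row `n + 1`) for the last one. As the strands only go to
the right and up, a piece goes up from row `m - 1` to row `m` exactly once for each row `m` that
it reaches. -/
def LeftPath (n : ℤ) : List Stage → ℤ → ℤ → Prop
  | [], _, _ => False
  | S :: L, c, m =>
      (S.row < m ∧ m ≤ startRow n L ∧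
        Follows S.graph (.v S.col (S.row + 1)) (.v c m)) ∨ LeftPath n L c m

/-- The right path of an insertion, recorded in the same way as the left path; its pieces leave
the inserted intersections through their right sides. -/
def RightPath (n : ℤ) : List Stage → ℤ → ℤ → Prop
  | [], _, _ => False
  | S :: L, c, m =>
      (S.row < m ∧ m ≤ startRow n L ∧
        Follows S.graph (.h (S.col - 1) S.row) (.v c m)) ∨ RightPath n L c m

/-- The path `p` is weakly to the left of the path `q`: wherever both go up from row `m - 1` to
row `m`, the column of `p` is that of `q` or lies to the left of it (has a larger number). -/
def WeaklyLeft (p q : ℤ → ℤ → Prop) : Prop :=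
  ∀ m c d : ℤ, p c m → q d m → d ≤ c

end RCGraph

namespace RCGraph

/-! Each step along a strand raises the antidiagonal `k - i` by one. On one antidiagonal each label
occurs at most once, the edges are ordered by height, and two strands can exchange places only at a
crossing. A strand starts at the top of its antidiagonal, so two strands out of label order have
crossed before (`exists_cross`). Hence the given rc-graph is `Good`: at each crossing the larger
label enters from the left and is positive. Conversely, `Good` tables are rc-graphs.

A crossing added at an open space interchanges two labels on all later antidiagonals. If the two
strands also cross later, removing that crossing ends the interchange there. A planarity argument
(`Good.swap_lt`) shows that all other crossings stay good. So at every stage the table without the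
newest crossing is `Good`, although the table with it may not be an rc-graph; and since the removed
crossing lies strictly higher, the algorithm stops.

In a `Good` table a nonpositive strand never passes a crossing from the left, so in each row it goes
straight up or shifts by exactly one column. On each piece, the left path is the nonpositive strand
after the modification, and the right path runs where that same strand ran before it. This gives the
step rules collected in `Trace`; moreover no nonpositive strand goes up between the two paths. The
two comparisons (`Trace.lam_le_rho`, `Trace.lam_le_rho_of_lt`) are inductions on the row: where the
paths touch, the step rules keep them from passing each other, and where a left path jumps to a new
open space, it passes only nonpositive strands, whereas the other insertion's paths are tied to
positive ones. -/

/-- The column of the cell entered through an edge. -/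
def Edge.col : Edge → ℤ
  | .h i _ => i
  | .v i _ => i

/-- The antidiagonal of the cell entered through an edge. -/
def Edge.diag : Edge → ℤ
  | .h i k => k - i
  | .v i k => k - i

@[simp] theorem Edge.diag_h (i k : ℤ) : (Edge.h i k).diag = k - i := rfl

@[simp] theorem Edge.diag_v (i k : ℤ) : (Edge.v i k).diag = k - i := rfl

/-- The height of an edge among the edges of its antidiagonal. -/
def Edge.pos : Edge → ℤ
  | .h _ k => 2 * k + 1
  | .v _ k => 2 * k

/-- The row of the cell entered through an edge. -/
def Edge.row : Edge → ℤ
  | .h _ k => k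
  | .v _ k => k

theorem Edge.ext_diag_pos {e e' : Edge} (hd : e.diag = e'.diag) (hp : e.pos = e'.pos) :
    e = e' := by
  cases e <;> cases e' <;> simp only [Edge.diag, Edge.pos] at hd hp <;> simp <;> omega

/-! ### Single steps and the order on an antidiagonal -/

section next

variable (n : ℤ) (R : Finset (ℤ × ℤ))

theorem diag_next (e : Edge) : (next R e).diag = e.diag + 1 := by
  cases e <;> simp only [next] <;> split_ifs <;> simp only [Edge.diag] <;> ring

theorem col_next_le (e : Edge) : (next R e).col ≤ e.col := by
  cases e <;> simp only [next] <;> split_ifs <;> simp only [Edge.col] <;> omega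

theorem row_le_next (e : Edge) : e.row ≤ (next R e).row := by
  cases e <;> simp only [next] <;> split_ifs <;> simp only [Edge.row] <;> omega

theorem diag_iterate (e : Edge) (t : ℕ) : ((next R)^[t] e).diag = e.diag + t := by
  induction t with
  | zero => simp
  | succ t ih => rw [Function.iterate_succ_apply', diag_next, ih]; push_cast; ring

theorem col_iterate_le (e : Edge) (t : ℕ) : ((next R)^[t] e).col ≤ e.col := by
  induction t with
  | zero => simp
  | succ t ih => rw [Function.iterate_succ_apply']; exact (col_next_le R _).trans ih

theorem row_le_iterate (e : Edge) (t : ℕ) : e.row ≤ ((next R)^[t] e).row := by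
  induction t with
  | zero => simp
  | succ t ih => rw [Function.iterate_succ_apply']; exact ih.trans (row_le_next R _)

theorem next_injective : Function.Injective (next R) := by
  intro e e' h
  have hd : e.diag = e'.diag := by
    have := congrArg Edge.diag h
    rw [diag_next, diag_next] at this
    omega
  rcases e with ⟨i, k⟩ | ⟨i, k⟩ <;> rcases e' with ⟨i', k'⟩ | ⟨i', k'⟩ <;>
    simp only [next] at h <;> simp only [Edge.diag] at hd <;>
    split_ifs at h with h1 h2 h2 <;> simp at h ⊢ <;> first | omega | skip
  all_goals
    obtain ⟨rfl, rfl⟩ : i = i' ∧ k = k' := by omega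
    contradiction

/-- Two strands on one antidiagonal keep their order unless they cross. -/
theorem pos_next_lt {e e' : Edge} (hd : e.diag = e'.diag) (hp : e.pos < e'.pos) :
    (next R e).pos < (next R e').pos ∨
      ∃ i k, (i, k) ∈ R ∧ e = .v i k ∧ e' = .h i k := by
  rcases e with ⟨i, k⟩ | ⟨i, k⟩ <;> rcases e' with ⟨i', k'⟩ | ⟨i', k'⟩ <;>
    simp only [Edge.diag, Edge.pos] at hd hp
  · left
    simp only [next]; split_ifs <;> simp only [Edge.pos] <;> omega
  · left
    simp only [next]; split_ifs <;> simp only [Edge.pos] <;> omega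
  · by_cases hk : k = k'
    · obtain rfl : i = i' := by omega
      subst hk
      by_cases h : (i, k) ∈ R
      · exact Or.inr ⟨i, k, h, rfl, rfl⟩
      · left; simp [next, h, Edge.pos]; omega
    · left
      simp only [next]; split_ifs <;> simp only [Edge.pos] <;> omega
  · left
    simp only [next]; split_ifs <;> simp only [Edge.pos] <;> omega

/-- Without crossings a strand alternately turns up and right, so two steps shift it by one column
and one row. -/
theorem iterate_zigzag (a : ℤ) (t : ℕ)
    (h : ∀ s : ℕ, s < t → (n - s, a + s) ∉ R ∧ (n - s, a + s + 1) ∉ R) :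
    (next R)^[2 * t] (.h n a) = .h (n - t) (a + t) := by
  induction t with
  | zero => simp
  | succ t ih =>
    have h1 := h t (by omega)
    rw [show 2 * (t + 1) = (2 * t + 1) + 1 by ring, Function.iterate_succ_apply',
      Function.iterate_succ_apply', ih (fun s hs => h s (by omega))]
    simp only [next, h1.1, h1.2, if_false]
    push_cast
    congr 1 <;> ring

end next

/-! ### Strand labels of edges -/

section lab

variable {n : ℤ} {R : Finset (ℤ × ℤ)}

theorem OnStrand.col_le {a : ℤ} {e : Edge} (h : OnStrand n R a e) : e.col ≤ n := by
  obtain ⟨t, rfl⟩ := h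
  exact col_iterate_le R _ t

theorem OnStrand.next {a : ℤ} {e : Edge} (h : OnStrand n R a e) :
    OnStrand n R a (next R e) := by
  obtain ⟨t, rfl⟩ := h
  exact ⟨t + 1, Function.iterate_succ_apply' _ _ _⟩

/-- Steps are injective, so a common edge forces one start to lie on the other strand; but no step
ends on the left side of column `n`. -/
theorem OnStrand.unique {a b : ℤ} {e : Edge} (ha : OnStrand n R a e) (hb : OnStrand n R b e) :
    a = b := by
  wlog hab : a ≤ b generalizing a b
  · exact (this hb ha (by omega)).symm
  obtain ⟨t, ht⟩ := ha
  obtain ⟨s, hs⟩ := hb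
  have h1 := diag_iterate R (.h n a) t
  have h2 := diag_iterate R (.h n b) s
  rw [ht] at h1
  rw [hs] at h2
  simp only [Edge.diag] at h1 h2
  obtain ⟨r, rfl⟩ : ∃ r, t = s + r := ⟨t - s, by omega⟩
  rw [Function.iterate_add_apply] at ht
  have h3 := (next_injective R).iterate s (ht.trans hs.symm)
  rcases r with _ | r
  · push_cast at *; omega
  · exfalso
    rw [Function.iterate_succ_apply'] at h3
    have h4 := col_iterate_le R (.h n a) r
    set e' := (RCGraph.next R)^[r] (.h n a)
    rcases e' with ⟨i, k⟩ | ⟨i, k⟩ <;> simp only [RCGraph.next] at h3 <;> split_ifs at h3 <;>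
      simp [Edge.col] at h3 h4 <;> omega

theorem onStrand_of_rows {i k : ℤ} (hi : i ≤ n) (hk : ∀ c ∈ R, k < c.2) :
    OnStrand n R (k + i - n) (.h i k) := by
  refine ⟨2 * (n - i).toNat, ?_⟩
  have hn : (((n - i).toNat : ℕ) : ℤ) = n - i := Int.toNat_of_nonneg (by omega)
  rw [iterate_zigzag n R _ _ fun s hs => ⟨fun h => ?_, fun h => ?_⟩, hn]
  · congr 1 <;> ring
  all_goals
    have := hk _ h
    simp only at this
    omega

/-- The zigzag from the left end visits only cells with coordinate sum `i + k` or `i + k + 1`. This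
serves the far right part of a row. -/
theorem onStrand_of_sum {i k : ℤ} (hi : i ≤ n) (hk : ∀ c ∈ R, i + k + 1 < c.1 + c.2) :
    OnStrand n R (k + i - n) (.h i k) := by
  refine ⟨2 * (n - i).toNat, ?_⟩
  have hn : (((n - i).toNat : ℕ) : ℤ) = n - i := Int.toNat_of_nonneg (by omega)
  rw [iterate_zigzag n R _ _ fun s hs => ⟨fun h => ?_, fun h => ?_⟩, hn]
  · congr 1 <;> ring
  all_goals
    have := hk _ h
    simp only at this
    omega

theorem exists_forall_lt (R : Finset (ℤ × ℤ)) (f : ℤ × ℤ → ℤ) : ∃ K, ∀ c ∈ R, K < f c := by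
  obtain ⟨K, hK⟩ := (R.image f).bddBelow
  refine ⟨K - 1, fun c hc => ?_⟩
  have := hK (Finset.mem_coe.2 (Finset.mem_image_of_mem f hc))
  omega

variable (R) in
-- Tracing back, each step goes left or down, and below all crossings the strand is an explicit
-- zigzag.
theorem exists_onStrand {e : Edge} (he : e.col ≤ n) : ∃ a, OnStrand n R a e := by
  obtain ⟨K, hK⟩ := exists_forall_lt R Prod.snd
  have key : ∀ (N : ℕ) (e : Edge), e.col ≤ n → n - e.col + (e.row - K) ≤ N →
      ∃ a, OnStrand n R a e := by
    intro N
    induction N with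
    | zero =>
      rintro (⟨i, k⟩ | ⟨i, k⟩) he hN <;> simp only [Edge.col, Edge.row] at he hN
      · exact ⟨_, onStrand_of_rows he fun c hc => by have := hK c hc; omega⟩
      · have h1 := onStrand_of_rows (R := R) (k := k - 1) he
          fun c hc => by have := hK c hc; omega
        have h2 : (i, k - 1) ∉ R := fun h => by have := hK _ h; simp only at this; omega
        have h3 := h1.next
        simp only [next, h2, if_false, sub_add_cancel] at h3
        exact ⟨_, h3⟩
    | succ N ih =>
      rintro (⟨i, k⟩ | ⟨i, k⟩) he hN <;> simp only [Edge.col, Edge.row] at he hN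
      · by_cases hi : i = n
        · exact ⟨k, 0, by rw [hi]; rfl⟩
        · by_cases hc : (i + 1, k) ∈ R
          · obtain ⟨a, ha⟩ := ih (.h (i + 1) k) (by simp only [Edge.col]; omega)
              (by simp only [Edge.col, Edge.row]; push_cast at hN; omega)
            have := ha.next
            simp only [next, hc, if_true, add_sub_cancel_right] at this
            exact ⟨a, this⟩
          · obtain ⟨a, ha⟩ := ih (.v (i + 1) k) (by simp only [Edge.col]; omega)
              (by simp only [Edge.col, Edge.row]; push_cast at hN; omega)
            have := ha.next
            simp only [next, hc, if_false, add_sub_cancel_right] at this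
            exact ⟨a, this⟩
      · by_cases hc : (i, k - 1) ∈ R
        · obtain ⟨a, ha⟩ := ih (.v i (k - 1)) he
            (by simp only [Edge.col, Edge.row]; push_cast at hN; omega)
          have := ha.next
          simp only [next, hc, if_true, sub_add_cancel] at this
          exact ⟨a, this⟩
        · obtain ⟨a, ha⟩ := ih (.h i (k - 1)) he
            (by simp only [Edge.col, Edge.row]; push_cast at hN; omega)
          have := ha.next
          simp only [next, hc, if_false, sub_add_cancel] at this
          exact ⟨a, this⟩
  exact key (n - e.col + (e.row - K)).toNat e he (Int.self_le_toNat _)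

variable (n R) in
/-- The label of the strand through an edge. -/
noncomputable def lab (e : Edge) : ℤ := Classical.epsilon fun a => OnStrand n R a e

variable (R) in
theorem onStrand_lab {e : Edge} (he : e.col ≤ n) : OnStrand n R (lab n R e) e :=
  Classical.epsilon_spec (exists_onStrand R he)

theorem OnStrand.lab_eq {a : ℤ} {e : Edge} (h : OnStrand n R a e) : lab n R e = a :=
  (onStrand_lab R h.col_le).unique h

theorem onStrand_iff {a : ℤ} {e : Edge} : OnStrand n R a e ↔ e.col ≤ n ∧ lab n R e = a :=
  ⟨fun h => ⟨h.col_le, h.lab_eq⟩, fun h => h.2 ▸ onStrand_lab R h.1⟩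

variable (n R) in
theorem lab_left (k : ℤ) : lab n R (.h n k) = k := OnStrand.lab_eq ⟨0, rfl⟩

variable (R) in
theorem lab_next {e : Edge} (he : e.col ≤ n) : lab n R (next R e) = lab n R e :=
  (onStrand_lab R he).next.lab_eq

variable (R) in
theorem lab_iterate {e : Edge} (he : e.col ≤ n) (t : ℕ) :
    lab n R ((next R)^[t] e) = lab n R e := by
  induction t with
  | zero => rfl
  | succ t ih =>
    rw [Function.iterate_succ_apply', lab_next R ((col_iterate_le R e t).trans he), ih]

theorem Follows.lab_eq {e e' : Edge} (h : Follows R e e') (he : e.col ≤ n) :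
    lab n R e' = lab n R e := by
  obtain ⟨t, rfl⟩ := h
  exact lab_iterate R he t

theorem Follows.col_le {e e' : Edge} (h : Follows R e e') : e'.col ≤ e.col := by
  obtain ⟨t, rfl⟩ := h
  exact col_iterate_le R e t

theorem lab_right_of_mem {i k : ℤ} (hi : i ≤ n) (h : (i, k) ∈ R) :
    lab n R (.h (i - 1) k) = lab n R (.h i k) := by
  simpa [next, h] using lab_next (n := n) R (e := .h i k) hi

theorem lab_top_of_mem {i k : ℤ} (hi : i ≤ n) (h : (i, k) ∈ R) :
    lab n R (.v i (k + 1)) = lab n R (.v i k) := by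
  simpa [next, h] using lab_next (n := n) R (e := .v i k) hi

theorem lab_right_of_notMem {i k : ℤ} (hi : i ≤ n) (h : (i, k) ∉ R) :
    lab n R (.h (i - 1) k) = lab n R (.v i k) := by
  simpa [next, h] using lab_next (n := n) R (e := .v i k) hi

theorem lab_top_of_notMem {i k : ℤ} (hi : i ≤ n) (h : (i, k) ∉ R) :
    lab n R (.v i (k + 1)) = lab n R (.h i k) := by
  simpa [next, h] using lab_next (n := n) R (e := .h i k) hi

/-- The labeling is the only one that is constant along the strands. -/
theorem lab_eq_of_forall_next {L : Edge → ℤ} (h0 : ∀ k, L (.h n k) = k)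
    (h1 : ∀ e : Edge, e.col ≤ n → L (next R e) = L e) {e : Edge} (he : e.col ≤ n) :
    lab n R e = L e := by
  obtain ⟨t, ht⟩ := onStrand_lab R he
  have : ∀ s : ℕ, L ((next R)^[s] (.h n (lab n R e))) = lab n R e := by
    intro s
    induction s with
    | zero => exact h0 _
    | succ s ih => rw [Function.iterate_succ_apply', h1 _ (col_iterate_le R _ s), ih]
  rw [← this t, ht]

variable (R) in
theorem lab_le {e : Edge} (he : e.col ≤ n) : lab n R e ≤ n + e.diag := by
  obtain ⟨t, ht⟩ := onStrand_lab R he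
  have := diag_iterate R (.h n (lab n R e)) t
  rw [ht] at this
  simp only [Edge.diag] at this
  cases e <;> simp only [Edge.diag] at * <;> omega

/-- The antidiagonal counts the steps made since the start, so it determines the place on a given
strand. -/
theorem edge_eq_of_lab_eq {e e' : Edge} (he : e.col ≤ n) (he' : e'.col ≤ n)
    (hl : lab n R e = lab n R e') (hd : e.diag = e'.diag) : e = e' := by
  obtain ⟨t, ht⟩ := onStrand_lab R he
  obtain ⟨s, hs⟩ := onStrand_lab R he'
  have h1 := diag_iterate R (.h n (lab n R e)) t
  have h2 := diag_iterate R (.h n (lab n R e')) s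
  rw [ht] at h1
  rw [hs, ← hl] at h2
  have : t = s := by omega
  rw [← ht, ← hs, hl, this]

theorem exists_iterate_of_lab_eq {e e' : Edge} (he : e.col ≤ n) (he' : e'.col ≤ n)
    (hl : lab n R e = lab n R e') (hd : e.diag ≤ e'.diag) :
    e' = (next R)^[(e'.diag - e.diag).toNat] e := by
  refine edge_eq_of_lab_eq (R := R) he' ((col_iterate_le R _ _).trans he) ?_ ?_
  · rw [lab_iterate R he, hl]
  · rw [diag_iterate]; omega

theorem row_le_of_lab_eq {e e' : Edge} (he : e.col ≤ n) (he' : e'.col ≤ n)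
    (hl : lab n R e = lab n R e') (hd : e.diag ≤ e'.diag) : e.row ≤ e'.row := by
  rw [exists_iterate_of_lab_eq he he' hl hd]
  exact row_le_iterate R _ _

variable (R) in
theorem exists_lab_eq_diag_eq {a d : ℤ} (h : a ≤ n + d) :
    ∃ e : Edge, e.col ≤ n ∧ lab n R e = a ∧ e.diag = d := by
  refine ⟨(next R)^[(n + d - a).toNat] (.h n a), col_iterate_le R _ _, ?_, ?_⟩
  · rw [lab_iterate R (by simp [Edge.col]), lab_left]
  · rw [diag_iterate]; simp only [Edge.diag]; omega

/-- A strand goes up into each row at most once. -/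
theorem col_eq_of_lab_v_eq {c d m : ℤ} (hc : c ≤ n) (hd : d ≤ n)
    (hl : lab n R (.v c m) = lab n R (.v d m)) : c = d := by
  wlog hcd : d ≤ c generalizing c d
  · exact (this hd hc hl.symm (by omega)).symm
  have h := exists_iterate_of_lab_eq (e := .v c m) (e' := .v d m) hc hd hl
    (by simp only [Edge.diag]; omega)
  -- Having entered row `m` from below, a strand uses horizontal edges there until it leaves for a
  -- higher row.
  have key : ∀ t : ℕ, (∃ j, j < c ∧ (next R)^[t + 1] (.v c m) = .h j m) ∨
      m < ((next R)^[t + 1] (.v c m)).row := by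
    intro t
    induction t with
    | zero =>
      simp only [zero_add, Function.iterate_one, next]
      split_ifs
      · right; simp [Edge.row]
      · left; exact ⟨c - 1, by omega, rfl⟩
    | succ t ih =>
      rw [Function.iterate_succ_apply']
      rcases ih with ⟨j, hj, h⟩ | h
      · rw [h]
        simp only [next]
        split_ifs
        · left; exact ⟨j - 1, by omega, rfl⟩
        · right; simp [Edge.row]
      · right; exact h.trans_le (row_le_next R _)
  rcases hN : (Edge.diag (.v d m) - Edge.diag (.v c m)).toNat with _ | t
  · rw [hN] at h
    simpa [eq_comm] using h
  · rw [hN] at h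
    rcases key t with ⟨j, -, h'⟩ | h'
    · rw [← h] at h'; simp at h'
    · rw [← h] at h'; simp [Edge.row] at h'

end lab

/-! ### Labels under changes of the table -/

/-- The edge lies below row `m` or leads into it from below. -/
def Edge.Below (m : ℤ) : Edge → Prop
  | .h _ k => k < m
  | .v _ k => k ≤ m

/-- Rows never decrease along a strand, so the part leading to such an edge only meets cells below
row `m`. -/
theorem lab_congr_below {n m : ℤ} {R R' : Finset (ℤ × ℤ)}
    (hR : ∀ i k, k < m → ((i, k) ∈ R ↔ (i, k) ∈ R')) {e : Edge} (he : e.col ≤ n)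
    (hb : e.Below m) : lab n R e = lab n R' e := by
  obtain ⟨t, ht⟩ := onStrand_lab R he
  have key : ∀ (t : ℕ) (a : ℤ) (e : Edge), e.Below m → (next R)^[t] (.h n a) = e →
      (next R')^[t] (.h n a) = e := by
    intro t a
    induction t with
    | zero => exact fun e _ h => h
    | succ t ih =>
      intro e hb h
      rw [Function.iterate_succ_apply'] at h ⊢
      have h0 := ih ((next R)^[t] (.h n a))
      generalize (next R)^[t] (.h n a) = e0 at h h0
      have hb0 : e0.row < m := by
        subst h
        cases e0 <;> simp only [next] at hb <;> split_ifs at hb <;>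
          simp only [Edge.Below, Edge.row] at * <;> omega
      rw [h0 (by cases e0 <;> simp only [Edge.Below, Edge.row] at * <;> omega) rfl, ← h]
      rcases e0 with ⟨i, k⟩ | ⟨i, k⟩ <;> simp only [next, hR i k hb0]
  exact (OnStrand.lab_eq ⟨t, key t _ e hb ht⟩).symm

theorem next_congr {R R' : Finset (ℤ × ℤ)} {e : Edge}
    (h : ∀ i k, e = .h i k ∨ e = .v i k → ((i, k) ∈ R ↔ (i, k) ∈ R')) : next R e = next R' e := by
  rcases e with ⟨i, k⟩ | ⟨i, k⟩ <;> simp [next, h i k]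

/-- Inserting a crossing interchanges the two labels behind it. -/
theorem lab_insert {n i k : ℤ} {R : Finset (ℤ × ℤ)} (hi : i ≤ n) (hp : (i, k) ∉ R) {e : Edge}
    (he : e.col ≤ n) :
    lab n (insert (i, k) R) e = if e.diag ≤ k - i then lab n R e else
      Equiv.swap (lab n R (.h i k)) (lab n R (.v i k)) (lab n R e) := by
  set a := lab n R (.h i k) with ha
  set b := lab n R (.v i k) with hb
  have hA : a ≤ n + (k - i) := lab_le R (e := .h i k) hi
  have hB : b ≤ n + (k - i) := lab_le R (e := .v i k) hi
  refine lab_eq_of_forall_next (L := fun e => if e.diag ≤ k - i then lab n R e else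
      Equiv.swap a b (lab n R e)) ?_ ?_ he
  · intro m
    simp only [Edge.diag, lab_left]
    split_ifs
    · rfl
    · exact Equiv.swap_apply_of_ne_of_ne (by omega) (by omega)
  · intro e he
    simp only [diag_next]
    by_cases hc : e = .h i k ∨ e = .v i k
    · rcases hc with rfl | rfl
      · have : next (insert (i, k) R) (.h i k) = .h (i - 1) k := by simp [next]
        rw [this, lab_right_of_notMem hi hp]
        simp [Edge.diag, ← ha, ← hb]
      · have : next (insert (i, k) R) (.v i k) = .v i (k + 1) := by simp [next]
        rw [this, lab_top_of_notMem hi hp]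
        simp [Edge.diag, ← ha, ← hb]
    · have hn : next (insert (i, k) R) e = next R e := by
        refine next_congr fun i' k' h => ?_
        rw [Finset.mem_insert, or_iff_right]
        rintro ⟨rfl, rfl⟩
        exact hc h
      rw [hn, lab_next R he]
      split_ifs with h1 h2 h2
      · rfl
      · omega
      · push Not at hc
        refine Equiv.swap_apply_of_ne_of_ne (fun h => hc.1 ?_) fun h => hc.2 ?_
        · exact edge_eq_of_lab_eq he hi h (show e.diag = k - i by omega)
        · exact edge_eq_of_lab_eq he hi h (show e.diag = k - i by omega)
      · rfl

/-- Removing a crossing interchanges the two labels behind it. -/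
theorem lab_erase {n i k : ℤ} {R : Finset (ℤ × ℤ)} (hi : i ≤ n) (hp : (i, k) ∈ R) {e : Edge}
    (he : e.col ≤ n) :
    lab n (R.erase (i, k)) e = if e.diag ≤ k - i then lab n R e else
      Equiv.swap (lab n R (.h i k)) (lab n R (.v i k)) (lab n R e) := by
  have hn : (i, k) ∉ R.erase (i, k) := by simp
  have key := fun {e : Edge} => lab_insert (e := e) hi hn
  rw [Finset.insert_erase hp] at key
  have h1 := key (e := .h i k) hi
  have h2 := key (e := .v i k) hi
  simp only [Edge.diag, le_refl, if_true] at h1 h2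
  rw [h1, h2, key he]
  split_ifs
  · rfl
  · simp

/-! ### Good tables and moving a crossing -/

section order

variable {n : ℤ} {R : Finset (ℤ × ℤ)}

/-- Strands whose order is not that of their labels have crossed. -/
theorem exists_cross {e e' : Edge} (he : e.col ≤ n) (he' : e'.col ≤ n) (hd : e.diag = e'.diag)
    (hp : e.pos < e'.pos) (hl : lab n R e' < lab n R e) :
    ∃ i k, (i, k) ∈ R ∧ i ≤ n ∧ lab n R (.h i k) = lab n R e ∧ lab n R (.v i k) = lab n R e' ∧
      k - i < e.diag := by
  have h1 := lab_le R he
  -- The two strands are compared from the antidiagonal on which the larger label `u` starts; its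
  -- starting edge is the highest one there.
  obtain ⟨f, hf, hfl, hfd⟩ := exists_lab_eq_diag_eq R (n := n) (a := lab n R e')
    (d := lab n R e - n) (by omega)
  set u := lab n R e with hu
  have hgd : Edge.diag (.h n u) = u - n := rfl
  have hgl : lab n R (.h n u) = u := lab_left n R u
  have hgc : Edge.col (.h n u) ≤ n := le_refl n
  have hfp : f.pos < Edge.pos (.h n u) := by
    refine lt_of_le_of_ne ?_ fun h => ?_
    · cases f <;> simp only [Edge.col, Edge.diag, Edge.pos] at * <;> omega
    · rw [Edge.ext_diag_pos (hfd.trans hgd.symm) h, hgl] at hfl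
      omega
  have key : ∀ t : ℕ, ((next R)^[t] f).pos < ((next R)^[t] (.h n u)).pos ∨
      ∃ i k, (i, k) ∈ R ∧ i ≤ n ∧ lab n R (.h i k) = u ∧
        lab n R (.v i k) = lab n R e' ∧ k - i < u - n + t := by
    intro t
    induction t with
    | zero => exact Or.inl hfp
    | succ t ih =>
      rcases ih with ih | ⟨i, k, h1, h2, h3, h4, h5⟩
      · rw [Function.iterate_succ_apply', Function.iterate_succ_apply']
        refine (pos_next_lt R ?_ ih).imp id ?_
        · rw [diag_iterate, diag_iterate, hfd, hgd]
        · rintro ⟨i, k, h1, h2, h3⟩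
          have hc := col_iterate_le R f t
          have hd := diag_iterate R f t
          have hl := lab_iterate R hf t
          have hl' := lab_iterate R hgc t
          rw [h2] at hc hd hl
          rw [h3] at hl'
          simp only [Edge.col, Edge.diag] at hc hd
          exact ⟨i, k, h1, by cases f <;> simp only [Edge.col] at * <;> omega, hl'.trans hgl,
            hl.trans hfl, by cases f <;> simp only [Edge.diag] at * <;> push_cast <;> omega⟩
      · exact Or.inr ⟨i, k, h1, h2, h3, h4, by push_cast; omega⟩
  have h2 := exists_iterate_of_lab_eq (R := R) hgc he (by rw [hgl]) (by omega)
  have h3 := exists_iterate_of_lab_eq (R := R) hf he' hfl (by omega)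
  rw [← hd, hfd] at h3
  rw [hgd] at h2
  rcases key (e.diag - (u - n)).toNat with h | ⟨i, k, h⟩
  · rw [← h2, ← h3] at h
    omega
  · exact ⟨i, k, h.1, h.2.1, h.2.2.1, h.2.2.2.1, by omega⟩

/-- At each crossing the strand entering from the left is positive and has the larger label. -/
def Good (n : ℤ) (R : Finset (ℤ × ℤ)) : Prop :=
  ∀ i k, (i, k) ∈ R → i ≤ n ∧ k ≤ n ∧ lab n R (.v i k) < lab n R (.h i k) ∧
    0 < lab n R (.h i k)

/-- Strands that have crossed do not cross again. -/
theorem Good.pos_lt (hR : Good n R) {e e' f f' : Edge} (he : e.col ≤ n) (he' : e'.col ≤ n)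
    (hf : f.col ≤ n) (hf' : f'.col ≤ n) (hd : e.diag = e'.diag)
    (hp : e.pos < e'.pos) (hl : lab n R e' < lab n R e) (hfd : f.diag = f'.diag)
    (hfl : lab n R f = lab n R e) (hfl' : lab n R f' = lab n R e') (hef : e.diag ≤ f.diag) :
    f.pos < f'.pos := by
  have key : ∀ t : ℕ, ((next R)^[t] e).pos < ((next R)^[t] e').pos := by
    intro t
    induction t with
    | zero => exact hp
    | succ t ih =>
      rw [Function.iterate_succ_apply', Function.iterate_succ_apply']
      refine (pos_next_lt R ?_ ih).resolve_right ?_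
      · rw [diag_iterate, diag_iterate, hd]
      · rintro ⟨i, k, h1, h2, h3⟩
        have hl1 := lab_iterate R he t
        have hl2 := lab_iterate R he' t
        rw [h2] at hl1
        rw [h3] at hl2
        have := (hR i k h1).2.2.1
        omega
  rw [exists_iterate_of_lab_eq he hf hfl.symm hef,
    exists_iterate_of_lab_eq he' hf' hfl'.symm (by omega), ← hd, ← hfd]
  exact key _

theorem Good.pos_lt_of_cross (hR : Good n R) {i k : ℤ} (hc : (i, k) ∈ R) {f f' : Edge}
    (hf : f.col ≤ n) (hf' : f'.col ≤ n) (hfd : f.diag = f'.diag)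
    (hfl : lab n R f = lab n R (.h i k)) (hfl' : lab n R f' = lab n R (.v i k))
    (hef : k - i < f.diag) : f.pos < f'.pos := by
  obtain ⟨hi, -, hlt, -⟩ := hR i k hc
  have h1 := lab_right_of_mem hi hc
  have h2 := lab_top_of_mem hi hc
  refine hR.pos_lt (e := .h (i - 1) k) (e' := .v i (k + 1)) ?_ hi hf hf' ?_ ?_ ?_ hfd ?_ ?_ ?_
  · simp only [Edge.col]; omega
  · simp only [Edge.diag]; ring
  · simp only [Edge.pos]; omega
  · rw [h1, h2]; exact hlt
  · rw [hfl, h1]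
  · rw [hfl', h2]
  · simp only [Edge.diag] at *; omega

/-- Two labels cross at most once. -/
theorem Good.cross_unique (hR : Good n R) {i k i' k' : ℤ} (hc : (i, k) ∈ R) (hc' : (i', k') ∈ R)
    (hh : lab n R (.h i k) = lab n R (.h i' k')) (hv : lab n R (.v i k) = lab n R (.v i' k')) :
    i = i' ∧ k = k' := by
  wlog hd : k - i ≤ k' - i' generalizing i k i' k'
  · exact (this hc' hc hh.symm hv.symm (by omega)).imp Eq.symm Eq.symm
  have hi := (hR _ _ hc).1
  have hi' := (hR _ _ hc').1
  rcases hd.eq_or_lt with hd | hd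
  · have := edge_eq_of_lab_eq (R := R) (e := .h i k) (e' := .h i' k') hi hi' hh hd
    simpa using this
  · have := hR.pos_lt_of_cross hc (f := .h i' k') (f' := .v i' k') hi' hi' rfl hh.symm hv.symm hd
    simp only [Edge.pos] at this
    omega

theorem meet_iff {a b i k : ℤ} :
    Meet n R a b (i, k) ↔ i ≤ n ∧ lab n R (.h i k) = a ∧ lab n R (.v i k) = b := by
  simp only [Meet, onStrand_iff, Edge.col]
  tauto

theorem crossAt_iff {a b i k : ℤ} :
    CrossAt n R a b (i, k) ↔ (i, k) ∈ R ∧ i ≤ n ∧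
      (lab n R (.h i k) = a ∧ lab n R (.v i k) = b ∨
        lab n R (.h i k) = b ∧ lab n R (.v i k) = a) := by
  simp only [CrossAt, meet_iff]
  tauto

theorem isOpenSpace_iff {i k : ℤ} :
    IsOpenSpace n R i k ↔ i ≤ n ∧ (i, k) ∉ R ∧ 0 < lab n R (.h i k) ∧ lab n R (.v i k) ≤ 0 := by
  simp only [IsOpenSpace, meet_iff]
  constructor
  · rintro ⟨h, a, b, ha, hb, hi, rfl, rfl⟩
    exact ⟨hi, h, ha, hb⟩
  · rintro ⟨hi, h, ha, hb⟩
    exact ⟨h, _, _, ha, hb, hi, rfl, rfl⟩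

theorem Good.isRCGraph (hR : Good n R) : IsRCGraph n R := by
  refine ⟨fun c hc => ⟨(hR _ _ hc).1, (hR _ _ hc).2.1⟩, ?_⟩
  rintro a b hab ⟨i, k⟩ ⟨i', k'⟩ hc hc'
  rw [crossAt_iff] at hc hc'
  have h1 := (hR _ _ hc.1).2.2.1
  have h2 := (hR _ _ hc'.1).2.2.1
  obtain ⟨rfl, rfl⟩ := hR.cross_unique hc.1 hc'.1 (by omega) (by omega)
  rfl

/-- A larger label entering a crossing from below would be out of order, hence would have crossed
the other strand before, and the two would cross twice. -/
theorem IsRCGraph.good (hR : IsRCGraph n R) (hp : NoNonposCrossing n R) : Good n R := by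
  intro i k hc
  obtain ⟨hi, hk⟩ := hR.1 _ hc
  simp only at hi hk
  have hne : lab n R (.v i k) ≠ lab n R (.h i k) := fun h => by
    simpa using edge_eq_of_lab_eq (e := .v i k) (e' := .h i k) hi hi h rfl
  have hlt : lab n R (.v i k) < lab n R (.h i k) := by
    by_contra hlt
    obtain ⟨i', k', h1, h2, h3, h4, h5⟩ := exists_cross (R := R) (e := .v i k) (e' := .h i k)
      hi hi rfl (by simp only [Edge.pos]; omega) (by omega)
    have := hR.2 _ _ hne (i, k) (i', k') (crossAt_iff.2 ⟨hc, hi, Or.inr ⟨rfl, rfl⟩⟩)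
      (crossAt_iff.2 ⟨h1, h2, Or.inl ⟨h3, h4⟩⟩)
    simp only [Prod.mk.injEq, Edge.diag] at this h5
    omega
  refine ⟨hi, hk, hlt, ?_⟩
  by_contra h0
  exact hp _ _ hne (by omega) (by omega) (i, k) (crossAt_iff.2 ⟨hc, hi, Or.inr ⟨rfl, rfl⟩⟩)

/-- A crossing in the region affected by an insertion remains a good one. -/
theorem Good.swap_lt (hR : Good n R) {i k i' k' : ℤ} (ho : IsOpenSpace n R i k)
    (hc : (i', k') ∈ R) (hd : k - i < k' - i')
    (hne : ¬ (lab n R (.h i' k') = lab n R (.h i k) ∧ lab n R (.v i' k') = lab n R (.v i k)))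
    (hno : ∀ j m, (j, m) ∈ R → lab n R (.h j m) = lab n R (.h i k) →
      lab n R (.v j m) = lab n R (.v i k) → k' - i' ≤ m - j) :
    Equiv.swap (lab n R (.h i k)) (lab n R (.v i k)) (lab n R (.v i' k')) <
      Equiv.swap (lab n R (.h i k)) (lab n R (.v i k)) (lab n R (.h i' k')) ∧
    0 < Equiv.swap (lab n R (.h i k)) (lab n R (.v i k)) (lab n R (.h i' k')) := by
  obtain ⟨hi, hp, ha, hb⟩ := isOpenSpace_iff.1 ho
  obtain ⟨hi', -, hlt, hpos⟩ := hR _ _ hc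
  have hA := lab_le R (e := .h i k) hi
  have hB := lab_le R (e := .v i k) hi
  simp only [Edge.diag] at hA hB
  obtain ⟨ea, hea, hal, had⟩ := exists_lab_eq_diag_eq R (n := n) (a := lab n R (.h i k))
    (d := k' - i') (by omega)
  obtain ⟨eb, heb, hbl, hbd⟩ := exists_lab_eq_diag_eq R (n := n) (a := lab n R (.v i k))
    (d := k' - i') (by omega)
  -- The two strands of the open space have not crossed before this antidiagonal, so they are still
  -- in label order.
  have hpab : eb.pos < ea.pos := by
    rcases lt_trichotomy ea.pos eb.pos with h | h | h
    · obtain ⟨j, m, h1, h2, h3, h4, h5⟩ := exists_cross hea heb (had.trans hbd.symm) h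
        (by rw [hal, hbl]; omega)
      have := hno j m h1 (h3.trans hal) (h4.trans hbl)
      omega
    · rw [Edge.ext_diag_pos (had.trans hbd.symm) h, hbl] at hal
      omega
    · exact h
  -- an edge on the antidiagonal of the open space is not between its two edges
  have before : ∀ e : Edge, e.diag = k - i → e ≠ .h i k → e ≠ .v i k →
      e.pos < 2 * k ∨ 2 * k + 1 < e.pos := by
    intro e hd h1 h2
    have h3 : e.pos ≠ 2 * k + 1 := fun h => h1 (Edge.ext_diag_pos hd h)
    have h4 : e.pos ≠ 2 * k := fun h => h2 (Edge.ext_diag_pos hd h)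
    omega
  -- Otherwise the strand entering from below would lie between the two strands of the open space,
  -- which were adjacent before. If its label is below the nonpositive one, these two have crossed
  -- with a nonpositive label on the left. Otherwise it came from outside past one of the two,
  -- although it had already crossed that one.
  have hua : lab n R (.h i' k') ≠ lab n R (.h i k) := by
    intro hu
    have hw : lab n R (.v i' k') ≠ lab n R (.v i k) := fun h => hne ⟨hu, h⟩
    have hae : ea = .h i' k' := edge_eq_of_lab_eq hea hi' (hal.trans hu.symm) had
    have hbe : eb.pos < Edge.pos (.v i' k') := by
      refine lt_of_le_of_ne ?_ fun h => ?_
      · rw [hae] at hpab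
        simp only [Edge.pos] at hpab ⊢
        omega
      · rw [Edge.ext_diag_pos (e' := .v i' k') hbd h] at hbl
        exact hw hbl
    rcases lt_or_gt_of_ne hw with hw | hw
    · obtain ⟨j, m, h1, h2, h3, h4, h5⟩ := exists_cross (R := R) (e' := .v i' k') heb hi' hbd hbe
        (by omega)
      have := (hR _ _ h1).2.2.2
      omega
    · obtain ⟨ew, hew, hwl, hwd⟩ := exists_lab_eq_diag_eq R (n := n) (a := lab n R (.v i' k'))
        (d := k - i) (by omega)
      rcases before ew hwd (by rintro rfl; omega) (by rintro rfl; omega) with h | h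
      · have := hR.pos_lt (e := ew) (e' := .v i k) (f := .v i' k') (f' := eb) hew hi hi' heb
          hwd h (by omega) hbd.symm hwl.symm hbl (by simp only [Edge.diag] at *; omega)
        omega
      · have := hR.pos_lt (e := .h i k) (e' := ew) (f := .h i' k') (f' := .v i' k') hi hew hi' hi'
          hwd.symm h (by omega) rfl hu hwl.symm hd.le
        simp only [Edge.pos] at this
        omega
  have hub : lab n R (.h i' k') ≠ lab n R (.v i k) := by omega
  rw [Equiv.swap_apply_of_ne_of_ne hua hub]
  refine ⟨?_, hpos⟩
  by_cases hwb : lab n R (.v i' k') = lab n R (.v i k)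
  · rw [hwb, Equiv.swap_apply_right]
    -- The same squeeze: now the strand entering from the left would lie between the two strands of
    -- the open space.
    by_contra hu
    have hbe : eb = .v i' k' := edge_eq_of_lab_eq heb hi' (hbl.trans hwb.symm) hbd
    have hae : Edge.pos (.h i' k') < ea.pos := by
      refine lt_of_le_of_ne ?_ fun h => ?_
      · rw [hbe] at hpab
        simp only [Edge.pos] at hpab ⊢
        omega
      · rw [← Edge.ext_diag_pos (e := .h i' k') had.symm h] at hal
        exact hua hal
    obtain ⟨eu, heu, hul, hud⟩ := exists_lab_eq_diag_eq R (n := n) (a := lab n R (.h i' k'))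
      (d := k - i) (by omega)
    rcases before eu hud (by rintro rfl; omega) (by rintro rfl; omega) with h | h
    · have := hR.pos_lt (e := eu) (e' := .v i k) (f := .h i' k') (f' := .v i' k') heu hi hi' hi'
        hud h (by omega) rfl hul.symm hwb (by simp only [Edge.diag] at *; omega)
      simp only [Edge.pos] at this
      omega
    · have := hR.pos_lt (e := .h i k) (e' := eu) (f := ea) (f' := .h i' k') hi heu hea hi'
        hud.symm h (by omega) had hal hul.symm (by simp only [Edge.diag] at *; omega)
      omega
  · by_cases hwa : lab n R (.v i' k') = lab n R (.h i k)
    · rw [hwa, Equiv.swap_apply_left]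
      omega
    · rw [Equiv.swap_apply_of_ne_of_ne hwa hwb]
      exact hlt

/-- Crossing two strands that do not cross elsewhere. -/
theorem Good.insert_openSpace (hR : Good n R) {i k : ℤ} (hk : k ≤ n) (ho : IsOpenSpace n R i k)
    (hno : ∀ j m, (j, m) ∈ R → lab n R (.h j m) = lab n R (.h i k) →
      lab n R (.v j m) ≠ lab n R (.v i k)) : Good n (insert (i, k) R) := by
  obtain ⟨hi, hp, ha, hb⟩ := isOpenSpace_iff.1 ho
  intro i' k' hc
  rw [Finset.mem_insert, Prod.mk.injEq] at hc
  rcases hc with ⟨rfl, rfl⟩ | hc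
  · rw [lab_insert hi hp (e := .v i' k') hi, lab_insert hi hp (e := .h i' k') hi]
    simp only [Edge.diag_h, Edge.diag_v, le_refl, if_true]
    exact ⟨hi, hk, by omega, ha⟩
  · obtain ⟨hi', hk', h1, h2⟩ := hR _ _ hc
    refine ⟨hi', hk', ?_⟩
    rw [lab_insert hi hp (e := .v i' k') hi', lab_insert hi hp (e := .h i' k') hi']
    simp only [Edge.diag_h, Edge.diag_v]
    by_cases hd : k' - i' ≤ k - i
    · simp only [hd, if_true]
      exact ⟨h1, h2⟩
    · simp only [hd, if_false]
      exact hR.swap_lt ho hc (by omega) (fun h => hno _ _ hc h.1 h.2)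
        fun j m h3 h4 h5 => absurd h5 (hno _ _ h3 h4)

/-- Behind a crossing the strand that came from the left stays below the other; at `(i, k)` it is
still above. -/
theorem Good.diag_lt_of_cross (hR : Good n R) {i k l m : ℤ} (hi : i ≤ n) (hp : (i, k) ∉ R)
    (hq : (l, m) ∈ R)
    (hh : lab n R (.h l m) = lab n R (.h i k)) (hv : lab n R (.v l m) = lab n R (.v i k)) :
    k - i < m - l := by
  have hl := (hR _ _ hq).1
  by_contra hd
  rcases (not_lt.1 hd).eq_or_lt with hd | hd
  · have := edge_eq_of_lab_eq (R := R) (e := .h l m) (e' := .h i k) hl hi hh hd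
    rw [Edge.h.injEq] at this
    obtain ⟨rfl, rfl⟩ := this
    exact hp hq
  · have := hR.pos_lt_of_cross hq (f := .h i k) (f' := .v i k) hi hi rfl hh.symm hv.symm hd
    simp only [Edge.pos] at this
    omega

/-- The labels after moving the crossing of two strands to an earlier place where they meet. -/
theorem Good.lab_move (hR : Good n R) {i k l m : ℤ} (hi : i ≤ n) (hp : (i, k) ∉ R)
    (hq : (l, m) ∈ R)
    (hh : lab n R (.h l m) = lab n R (.h i k)) (hv : lab n R (.v l m) = lab n R (.v i k))
    {e : Edge} (he : e.col ≤ n) :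
    lab n ((insert (i, k) R).erase (l, m)) e = if k - i < e.diag ∧ e.diag ≤ m - l then
      Equiv.swap (lab n R (.h i k)) (lab n R (.v i k)) (lab n R e) else lab n R e := by
  have hl := (hR _ _ hq).1
  have hd := hR.diag_lt_of_cross hi hp hq hh hv
  -- Beyond the removed crossing the interchanges caused by inserting and erasing cancel.
  rw [lab_erase hl (Finset.mem_insert_of_mem hq) he, lab_insert hi hp he,
    lab_insert hi hp (e := .h l m) hl, lab_insert hi hp (e := .v l m) hl]
  simp only [Edge.diag_h, Edge.diag_v, hh, hv, not_le.2 hd, if_false, Equiv.swap_apply_left,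
    Equiv.swap_apply_right]
  by_cases h1 : Edge.diag e ≤ m - l <;> by_cases h2 : Edge.diag e ≤ k - i
  · simp [h1, h2, not_lt.2 h2]
  · simp [h1, h2, not_le.1 h2]
  · omega
  · simp [h1, h2, Equiv.swap_comm]

/-- Moving the crossing of two strands to an earlier place where they meet. -/
theorem Good.move (hR : Good n R) {i k l m : ℤ} (hk : k ≤ n) (ho : IsOpenSpace n R i k)
    (hq : (l, m) ∈ R)
    (hh : lab n R (.h l m) = lab n R (.h i k)) (hv : lab n R (.v l m) = lab n R (.v i k)) :
    Good n ((insert (i, k) R).erase (l, m)) := by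
  obtain ⟨hi, hp, ha, hb⟩ := isOpenSpace_iff.1 ho
  have hl := (hR _ _ hq).1
  intro i' k' hc
  rw [Finset.mem_erase, Finset.mem_insert, Prod.mk.injEq] at hc
  obtain ⟨hcq, ⟨rfl, rfl⟩ | hc⟩ := hc
  · rw [hR.lab_move hi hp hq hh hv (e := .v i' k') hi,
      hR.lab_move hi hp hq hh hv (e := .h i' k') hi]
    simp only [Edge.diag_h, Edge.diag_v, lt_irrefl, false_and, if_false]
    exact ⟨hi, hk, by omega, ha⟩
  · obtain ⟨hi', hk', h1, h2⟩ := hR _ _ hc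
    refine ⟨hi', hk', ?_⟩
    rw [hR.lab_move hi hp hq hh hv (e := .v i' k') hi',
      hR.lab_move hi hp hq hh hv (e := .h i' k') hi']
    simp only [Edge.diag_h, Edge.diag_v]
    by_cases hd : k - i < k' - i' ∧ k' - i' ≤ m - l
    · simp only [hd, and_self, if_true]
      refine hR.swap_lt ho hc hd.1 (fun h => hcq ?_) fun j r h3 h4 h5 => ?_
      · obtain ⟨rfl, rfl⟩ := hR.cross_unique hc hq (h.1.trans hh.symm) (h.2.trans hv.symm)
        rfl
      · obtain ⟨rfl, rfl⟩ := hR.cross_unique h3 hq (h4.trans hh.symm) (h5.trans hv.symm)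
        exact hd.2
    · simp only [hd, if_false]
      exact ⟨h1, h2⟩

end order

/-! ### Open spaces in a row -/

section gap

variable {n : ℤ} {R : Finset (ℤ × ℤ)}

/-- A cell whose left side is positive and right side nonpositive is an open space: a crossing would
carry the label straight through. So, read leftwards, the sign cannot change before the first open
space. -/
theorem lab_h_nonpos_of_no_openSpace {l i k : ℤ} (hi : i ≤ n) (hl : lab n R (.h l k) ≤ 0)
    (hno : ∀ j, l < j → j < i → ¬ IsOpenSpace n R j k) :
    ∀ e, l ≤ e → e < i → lab n R (.h e k) ≤ 0 := by
  intro e he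
  induction e, he using Int.leInduction with
  | base => exact fun _ => hl
  | succ e he ih =>
    intro hei
    have h1 := ih (by omega)
    by_contra hpos
    refine hno (e + 1) (by omega) hei (isOpenSpace_iff.2 ⟨by omega, fun hc => ?_, by omega, ?_⟩)
    · have := lab_right_of_mem (n := n) (by omega) hc
      rw [add_sub_cancel_right] at this
      omega
    · by_cases hc : (e + 1, k) ∈ R
      · have := lab_right_of_mem (n := n) (by omega) hc
        rw [add_sub_cancel_right] at this
        omega
      · have := lab_right_of_notMem (n := n) (by omega) hc
        rw [add_sub_cancel_right] at this
        omega

/-- The leftmost edge of row `k` has the positive label `k`, so the sign changes somewhere to the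
left of `l`. -/
theorem exists_isLeast_openSpace {l k : ℤ} (hl : l ≤ n) (hk : 0 < k)
    (hneg : lab n R (.h l k) ≤ 0) : ∃ i, IsLeast {i | l < i ∧ IsOpenSpace n R i k} i := by
  have hex : ∃ i, l < i ∧ IsOpenSpace n R i k := by
    by_contra! hno
    have hln : l < n := lt_of_le_of_ne hl fun h => by rw [h, lab_left] at hneg; omega
    have h1 := lab_h_nonpos_of_no_openSpace le_rfl hneg (fun j hj _ => hno j hj) (n - 1)
      (by omega) (by omega)
    refine hno n hln (isOpenSpace_iff.2 ⟨le_rfl, fun hc => ?_, by rw [lab_left]; omega, ?_⟩)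
    · rw [lab_right_of_mem le_rfl hc, lab_left] at h1
      omega
    · by_cases hc : (n, k) ∈ R
      · rw [lab_right_of_mem le_rfl hc, lab_left] at h1
        omega
      · rwa [lab_right_of_notMem le_rfl hc] at h1
  obtain ⟨i, hi, hmin⟩ := Int.exists_least_of_bdd ⟨l, fun z hz => hz.1.le⟩ hex
  exact ⟨i, hi, fun z hz => hmin z hz⟩

variable (n R) in
theorem exists_lab_h_nonpos (k : ℤ) : ∃ e₀, e₀ ≤ n ∧ ∀ e ≤ e₀, lab n R (.h e k) ≤ 0 := by
  obtain ⟨K, hK⟩ := exists_forall_lt R fun c => c.1 + c.2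
  refine ⟨min (min n (n - k)) (K - k - 1), by omega, fun e he => ?_⟩
  have := (onStrand_of_sum (n := n) (R := R) (i := e) (k := k) (by omega)
    fun c hc => by have := hK c hc; omega).lab_eq
  omega

variable (R) in
theorem exists_isLeast_openSpace_row {k : ℤ} (hk : 0 < k) :
    ∃ i, IsLeast {i | IsOpenSpace n R i k} i := by
  obtain ⟨e₀, hn, he⟩ := exists_lab_h_nonpos n R k
  obtain ⟨i, hi, hmin⟩ := exists_isLeast_openSpace hn hk (he e₀ le_rfl)
  refine ⟨i, hi.2, fun j hj => hmin ⟨?_, hj⟩⟩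
  by_contra h
  have h1 := he j (by omega)
  have h2 := (isOpenSpace_iff.1 hj).2.2.1
  omega

theorem lab_h_nonpos_of_isLeast {i k : ℤ} (h : IsLeast {i | IsOpenSpace n R i k} i) :
    ∀ e < i, lab n R (.h e k) ≤ 0 := by
  intro e he
  obtain ⟨e₀, hn, he₀⟩ := exists_lab_h_nonpos n R k
  refine lab_h_nonpos_of_no_openSpace (l := min e e₀) (isOpenSpace_iff.1 h.1).1
    (he₀ _ (by omega)) (fun j _ hj ho => ?_) e (by omega) he
  have := h.2 ho
  omega

theorem lab_h_nonpos_of_isLeast_gt {l i k : ℤ} (hl : lab n R (.h l k) ≤ 0)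
    (h : IsLeast {i | l < i ∧ IsOpenSpace n R i k} i) :
    ∀ e, l ≤ e → e < i → lab n R (.h e k) ≤ 0 := by
  refine lab_h_nonpos_of_no_openSpace (isOpenSpace_iff.1 h.1.2).1 hl fun j h1 hj ho => ?_
  have := h.2 ⟨h1, ho⟩
  omega

theorem Good.lab_top_nonpos (hR : Good n R) {e k : ℤ} (he : e ≤ n)
    (h : lab n R (.h e k) ≤ 0) : lab n R (.v e (k + 1)) ≤ 0 := by
  rwa [lab_top_of_notMem he fun hc => by have := (hR _ _ hc).2.2.2; omega]

theorem Good.lab_bottom_nonpos (hR : Good n R) {e k : ℤ} (he : e ≤ n)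
    (h : lab n R (.h e k) ≤ 0) (h' : lab n R (.h (e - 1) k) ≤ 0) : lab n R (.v e k) ≤ 0 := by
  rwa [← lab_right_of_notMem he fun hc => by have := (hR _ _ hc).2.2.2; omega]

end gap

/-! ### The two paths of a single stage -/

section stage

variable {n : ℤ}

/-- The columns in which a nonpositive strand goes up. -/
theorem Good.exists_ascent {R : Finset (ℤ × ℤ)} (hR : Good n R) {c k : ℤ} (hc : c ≤ n)
    (hneg : lab n R (.v c (k + 1)) ≤ 0) : ∃ f : ℤ → ℤ, f (k + 1) = c ∧
      (∀ m, k < m → f (m + 1) = if (f m, m) ∈ R then f m else f m - 1) ∧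
      (∀ m, k < m → f m ≤ c ∧ lab n R (.v (f m) m) = lab n R (.v c (k + 1))) ∧
      (∀ m m', k < m → m ≤ m' → f m' ≤ f m) := by
  obtain ⟨f, h0, hf⟩ : ∃ f : ℤ → ℤ, f (k + 1) = c ∧
      ∀ m, k < m → f (m + 1) = if (f m, m) ∈ R then f m else f m - 1 := by
    let g : ℕ → ℤ := fun t => Nat.rec c (fun t y => if (y, k + 1 + t) ∈ R then y else y - 1) t
    have hg : ∀ t : ℕ, g (t + 1) = if (g t, k + 1 + t) ∈ R then g t else g t - 1 := fun t => rfl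
    refine ⟨fun m => g (m - k - 1).toNat, ?_, fun m hm => ?_⟩
    · simp only [show (k + 1 - k - 1).toNat = 0 by omega]
      rfl
    · have h1 : (m + 1 - k - 1).toNat = (m - k - 1).toNat + 1 := by omega
      simp only [h1, hg, show k + 1 + ((m - k - 1).toNat : ℤ) = m by omega]
  refine ⟨f, h0, hf, fun m hm => ?_, fun m m' hm hmm => ?_⟩
  · have hm : k + 1 ≤ m := hm
    induction m, hm using Int.leInduction with
    | base => rw [h0]; exact ⟨le_rfl, rfl⟩
    | succ m hm ih =>
      obtain ⟨h1, h2⟩ := ih (by omega)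
      rw [hf m (by omega)]
      split_ifs with hx
      · exact ⟨h1, by rw [lab_top_of_mem (by omega) hx, h2]⟩
      -- Having turned right, the nonpositive strand cannot pass a crossing from the left, so it
      -- turns up in the very next column.
      · have h3 := lab_right_of_notMem (n := n) (by omega) hx
        refine ⟨by omega, ?_⟩
        rw [lab_top_of_notMem (by omega), h3, h2]
        intro h4
        have := (hR _ _ h4).2.2.2
        omega
  · induction m', hmm using Int.leInduction with
    | base => exact le_rfl
    | succ m' hm' ih =>
      refine le_trans ?_ ih
      rw [hf m' (by omega)]
      split_ifs <;> omega

/-- The two paths between two consecutive insertions, in the rows from `k` to `k'`: here `B` and `A`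
are the tables without and with the crossing inserted in row `k`, and `lam` and `rho` are the
columns of the left and the right path. -/
structure IsPiece (n : ℤ) (B A : Finset (ℤ × ℤ)) (i k k' : ℤ) (lam rho : ℤ → ℤ) : Prop where
  lam_start : lam (k + 1) = i
  rho_start : rho (k + 1) = i - 1
  lam_le : ∀ m, k < m → lam m ≤ n
  lam_step : ∀ m, k < m → m < k' → lam (m + 1) = if (lam m, m) ∈ B then lam m else lam m - 1
  rho_step : ∀ m, k < m → m < k' → rho (m + 1) = if (rho m, m) ∈ B then rho m else rho m - 1
  lab_lam : ∀ m, k < m → m ≤ k' → lab n A (.v (lam m) m) = lab n B (.v i k)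
  lab_rho : ∀ m, k < m → m ≤ k' → lab n A (.v (rho m) m) = lab n B (.h i k)
  rho_lt_lam : ∀ m, k < m → m ≤ k' → rho m < lam m
  lab_pos : ∀ m, k < m → m ≤ k' → ∀ e, rho m < e → e ≤ lam m → 0 < lab n B (.v e m)

/-- No nonpositive strand enters the region between the two paths. -/
theorem Good.lab_pos_between {B : Finset (ℤ × ℤ)} (hB : Good n B) {k k' : ℤ} {lam rho : ℤ → ℤ}
    (h0 : lam (k + 1) = rho (k + 1) + 1) (hlam : ∀ m, k < m → lam m ≤ n)
    (lam_step : ∀ m, k < m → m < k' → lam (m + 1) = if (lam m, m) ∈ B then lam m else lam m - 1)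
    (rho_step : ∀ m, k < m → m < k' → rho (m + 1) = if (rho m, m) ∈ B then rho m else rho m - 1)
    (hpos : ∀ m, k < m → m ≤ k' → 0 < lab n B (.v (lam m) m)) (m : ℤ) (hm : k < m)
    (hmk : m ≤ k') (hlt : ∀ m, k < m → m ≤ k' → rho m ≠ lam m) :
    rho m < lam m ∧ ∀ e, rho m < e → e ≤ lam m → 0 < lab n B (.v e m) := by
  have hm : k + 1 ≤ m := hm
  induction m, hm using Int.leInduction with
  | base =>
    refine ⟨by omega, fun e h1 h2 => ?_⟩
    obtain rfl : e = lam (k + 1) := by omega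
    exact hpos _ (by omega) hmk
  | succ m hm ih =>
    obtain ⟨ih1, ih2⟩ := ih (by omega) (by omega)
    have hl := lam_step m (by omega) (by omega)
    have hr := rho_step m (by omega) (by omega)
    have hne := hlt (m + 1) (by omega) hmk
    have hln := hlam m (by omega)
    have hl' : lam (m + 1) ≤ lam m := by rw [hl]; split_ifs <;> omega
    have hr' : rho m - 1 ≤ rho (m + 1) ∧ rho (m + 1) ≤ rho m := by
      rw [hr]; split_ifs <;> omega
    have hl'' : lam m - 1 ≤ lam (m + 1) := by rw [hl]; split_ifs <;> omega
    refine ⟨by omega, fun e h1 h2 => ?_⟩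
    by_contra hneg
    by_cases hc : (e, m) ∈ B
    · rw [lab_top_of_mem (by omega) hc] at hneg
      refine hneg (ih2 e (lt_of_le_of_ne (by omega) ?_) (by omega))
      rintro rfl
      rw [if_pos hc] at hr
      omega
    -- A nonpositive strand going up at an uncrossed cell came from the left, and before that from
    -- below in column `e + 1`, which still belongs to the region.
    · have h3 : e ≠ lam (m + 1) := fun h => hneg (h ▸ hpos _ (by omega) hmk)
      rw [lab_top_of_notMem (by omega) hc] at hneg
      have h4 : (e + 1, m) ∉ B := fun h => by
        have h5 := lab_right_of_mem (n := n) (by omega) h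
        have := (hB _ _ h).2.2.2
        rw [add_sub_cancel_right] at h5
        omega
      have h5 := lab_right_of_notMem (n := n) (by omega) h4
      rw [add_sub_cancel_right] at h5
      have := ih2 (e + 1) (by omega) (by omega)
      omega

theorem Good.lab_right_up {B : Finset (ℤ × ℤ)} (hB : Good n B) {i k : ℤ}
    (ho : IsOpenSpace n B i k) : lab n B (.v (i - 1) (k + 1)) = lab n B (.v i k) := by
  obtain ⟨hi, hp, ha, hb⟩ := isOpenSpace_iff.1 ho
  have h1 := lab_right_of_notMem hi hp
  rw [lab_top_of_notMem (by omega) fun h => ?_, h1]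
  have := (hB _ _ h).2.2.2
  omega

/-- `lam` is the nonpositive strand in the new table and `rho` the same strand in the old one. As
labels are interchanged behind `(i, k)`, `lam` carries the positive label in the old table and `rho`
carries it in the new one. -/
theorem Good.exists_piece_insert {B : Finset (ℤ × ℤ)} (hB : Good n B) {i k : ℤ} (hk : k ≤ n)
    (ho : IsOpenSpace n B i k)
    (hno : ∀ j m, (j, m) ∈ B → lab n B (.h j m) = lab n B (.h i k) →
      lab n B (.v j m) ≠ lab n B (.v i k)) :
    ∃ lam rho, IsPiece n B (insert (i, k) B) i k (n + 1) lam rho := by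
  have hA := hB.insert_openSpace hk ho hno
  obtain ⟨hi, hp, ha, hb⟩ := isOpenSpace_iff.1 ho
  have hlab := fun {e : Edge} => lab_insert (e := e) hi hp
  have hru := hB.lab_right_up ho
  have hup : lab n (insert (i, k) B) (.v i (k + 1)) = lab n B (.v i k) := by
    rw [lab_top_of_mem hi (Finset.mem_insert_self _ _), hlab (e := .v i k) hi]
    simp
  obtain ⟨lam, l0, l1, l2, l3⟩ := hA.exists_ascent (c := i) (k := k) hi (by omega)
  obtain ⟨rho, r0, r1, r2, r3⟩ := hB.exists_ascent (c := i - 1) (k := k) (by omega) (by omega)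
  have hlam : ∀ m, k < m → lab n B (.v (lam m) m) = lab n B (.h i k) := by
    intro m hm
    obtain ⟨h1, h2⟩ := l2 m hm
    rw [hup, hlab (e := .v (lam m) m) (by simp only [Edge.col]; omega), Edge.diag_v,
      if_neg (by omega), Equiv.swap_apply_eq_iff, Equiv.swap_apply_right] at h2
    exact h2
  have hrho : ∀ m, k < m → lab n (insert (i, k) B) (.v (rho m) m) = lab n B (.h i k) := by
    intro m hm
    obtain ⟨h1, h2⟩ := r2 m hm
    rw [hlab (e := .v (rho m) m) (by simp only [Edge.col]; omega), Edge.diag_v,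
      if_neg (by omega), h2, hru, Equiv.swap_apply_right]
  have lam_step : ∀ m, k < m → m < n + 1 →
      lam (m + 1) = if (lam m, m) ∈ B then lam m else lam m - 1 := by
    intro m hm _
    rw [l1 m hm]
    simp [hm.ne']
  have hbet := fun m hm hm' => hB.lab_pos_between (k' := n + 1) (by rw [l0, r0]; ring)
    (fun m hm => (l2 m hm).1.trans hi) lam_step (fun m hm _ => r1 m hm)
    (fun m hm _ => by rw [hlam m hm]; exact ha) m hm hm' fun m hm _ h => by
      have h1 := hlam m hm
      have h2 := (r2 m hm).2
      rw [h] at h2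
      omega
  exact ⟨lam, rho, l0, r0, fun m hm => (l2 m hm).1.trans hi, lam_step, fun m hm _ => r1 m hm,
    fun m hm _ => (l2 m hm).2.trans hup, fun m hm _ => hrho m hm, fun m hm hm' => (hbet m hm hm').1,
    fun m hm hm' => (hbet m hm hm').2⟩

theorem Good.exists_piece_move {B : Finset (ℤ × ℤ)} (hB : Good n B) {i k l k' : ℤ} (hk : k ≤ n)
    (ho : IsOpenSpace n B i k) (hkk : k < k') (hq : (l, k') ∈ B)
    (hh : lab n B (.h l k') = lab n B (.h i k)) (hv : lab n B (.v l k') = lab n B (.v i k)) :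
    ∃ lam rho, IsPiece n B ((insert (i, k) B).erase (l, k')) i k k' lam rho ∧
      lam k' = l + 1 ∧ rho k' = l := by
  have hA := hB.move hk ho hq hh hv
  obtain ⟨hi, hp, ha, hb⟩ := isOpenSpace_iff.1 ho
  have hl := (hB _ _ hq).1
  have hk' := (hB _ _ hq).2.1
  have hlab := fun {e : Edge} => hB.lab_move (e := e) hi hp hq hh hv
  have hd := hB.diag_lt_of_cross hi hp hq hh hv
  set A := (insert (i, k) B).erase (l, k') with hAdef
  have hpA : (i, k) ∈ A := by simp [hAdef, hkk.ne]
  have hru := hB.lab_right_up ho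
  have hup : lab n A (.v i (k + 1)) = lab n B (.v i k) := by
    rw [lab_top_of_mem hi hpA, hlab (e := .v i k) hi]
    simp
  obtain ⟨lam, l0, l1, l2, l3⟩ := hA.exists_ascent (c := i) (k := k) hi (by omega)
  obtain ⟨rho, r0, r1, r2, r3⟩ := hB.exists_ascent (c := i - 1) (k := k) (by omega) (by omega)
  have hqA : lab n A (.h l k') = lab n B (.v i k) := by
    rw [hlab (e := .h l k') hl]
    simp [hd, hh]
  have hln : l < n := lt_of_le_of_ne hl fun h => by
    rw [h, lab_left] at hqA
    rw [h, lab_left] at hh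
    omega
  -- In `A` the nonpositive strand enters the vacated cell from the left, so it came up in column `l
  -- + 1`; this is where the left path ends.
  have hl1 : (l + 1, k') ∉ A := fun h => by
    have h1 := lab_right_of_mem (n := n) (by omega) h
    have := (hA _ _ h).2.2.2
    rw [add_sub_cancel_right] at h1
    omega
  have hlamk : lam k' = l + 1 := by
    refine col_eq_of_lab_v_eq (n := n) (R := A) (m := k') ((l2 k' hkk).1.trans hi) (by omega) ?_
    have h1 := lab_right_of_notMem (n := n) (by omega) hl1
    rw [add_sub_cancel_right] at h1
    rw [(l2 k' hkk).2, ← h1, hqA, hup]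
  have hrhok : rho k' = l := by
    refine col_eq_of_lab_v_eq (n := n) (R := B) (m := k') ?_ hl ?_
    · have := (r2 k' hkk).1
      omega
    · rw [(r2 k' hkk).2, hru, hv]
  have hlam : ∀ m, k < m → m ≤ k' → lab n B (.v (lam m) m) = lab n B (.h i k) := by
    intro m hm hm'
    obtain ⟨h1, h2⟩ := l2 m hm
    have h3 := l3 m k' hm hm'
    rw [hup, hlab (e := .v (lam m) m) (by simp only [Edge.col]; omega), Edge.diag_v,
      if_pos ⟨by omega, by omega⟩, Equiv.swap_apply_eq_iff, Equiv.swap_apply_right] at h2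
    exact h2
  have hrho : ∀ m, k < m → m ≤ k' → lab n A (.v (rho m) m) = lab n B (.h i k) := by
    intro m hm hm'
    obtain ⟨h1, h2⟩ := r2 m hm
    have h3 := r3 m k' hm hm'
    rw [hlab (e := .v (rho m) m) (by simp only [Edge.col]; omega), Edge.diag_v,
      if_pos ⟨by omega, by omega⟩, h2, hru, Equiv.swap_apply_right]
  have lam_step : ∀ m, k < m → m < k' →
      lam (m + 1) = if (lam m, m) ∈ B then lam m else lam m - 1 := by
    intro m hm hm'
    rw [l1 m hm]
    simp [hAdef, hm.ne', hm'.ne]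
  have hbet := fun m hm hm' => hB.lab_pos_between (k' := k') (by rw [l0, r0]; ring)
    (fun m hm => (l2 m hm).1.trans hi) lam_step (fun m hm _ => r1 m hm)
    (fun m hm hm' => by rw [hlam m hm hm']; exact ha) m hm hm' fun m hm hm' h => by
      have h1 := hlam m hm hm'
      have h2 := (r2 m hm).2
      rw [h] at h2
      omega
  exact ⟨lam, rho, ⟨l0, r0, fun m hm => (l2 m hm).1.trans hi, lam_step, fun m hm _ => r1 m hm,
    fun m hm _ => (l2 m hm).2.trans hup, hrho, fun m hm hm' => (hbet m hm hm').1,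
    fun m hm hm' => (hbet m hm hm').2⟩, hlamk, hrhok⟩

end stage

/-! ### Paths of a whole insertion -/

section trace

variable {n : ℤ}

/-- The columns `lam` and `rho` of the left and the right path of an insertion, which begins at the
cell `(i, x)` and turns the table `R` into `R'`. -/
structure Trace (n i x : ℤ) (R R' : Finset (ℤ × ℤ)) (lam rho : ℤ → ℤ) : Prop where
  lam_start : lam (x + 1) = i
  rho_start : rho (x + 1) = i - 1
  lam_le : ∀ m, x < m → lam m ≤ n
  rho_lt_lam : ∀ m, x < m → m ≤ n + 1 → rho m < lam m
  lab_pos : ∀ m, x < m → m ≤ n + 1 → ∀ e, rho m < e → e ≤ lam m → 0 < lab n R (.v e m)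
  lab_rho_pos : ∀ m, x < m → m ≤ n + 1 → 0 < lab n R' (.v (rho m) m)
  rho_step : ∀ m, x < m → m ≤ n → rho m - 1 ≤ rho (m + 1) ∧
    ((rho m, m) ∈ R ∨ (rho m, m) ∈ R' → rho m ≤ rho (m + 1))
  -- The second alternative describes the jump to the next inserted crossing, in row `m`: the
  -- columns passed over carry nonpositive strands.
  lam_step : ∀ m, x < m → m ≤ n →
    (lam (m + 1) ≤ lam m ∧ ((lam m, m) ∉ R ∨ (lam m, m) ∉ R' → lam (m + 1) < lam m)) ∨
    ((∀ e, lam m - 1 ≤ e → e < lam (m + 1) → lab n R (.v e (m + 1)) ≤ 0) ∧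
      (∀ e, lam m ≤ e → e ≤ lam (m + 1) → lab n R' (.v e m) ≤ 0) ∧ (lam (m + 1), m) ∈ R')
  mem_below : ∀ c d, d < x → ((c, d) ∈ R' ↔ (c, d) ∈ R)
  mem_row : ∀ c, (c, x) ∈ R' ↔ (c, x) ∈ insert (i, x) R

/-- A label goes up into a row in only one column, so comparing labels suffices; `A` and `S` have
the same labels up to the entry into row `k'`. -/
theorem IsPiece.left_unique {B A S : Finset (ℤ × ℤ)} {i k k' : ℤ} {lam rho : ℤ → ℤ}
    (h : IsPiece n B A i k k' lam rho) (ho : IsOpenSpace n B i k) (hS : S = insert (i, k) B)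
    (hA : ∀ c d, d < k' → ((c, d) ∈ A ↔ (c, d) ∈ S)) {c m : ℤ} (hm : k < m) (hm' : m ≤ k')
    (hf : Follows S (.v i (k + 1)) (.v c m)) : c = lam m := by
  obtain ⟨hi, hp, ha, hb⟩ := isOpenSpace_iff.1 ho
  have hlm := h.lam_le m hm
  refine col_eq_of_lab_v_eq (n := n) (R := S) (m := m) (hf.col_le.trans hi) hlm ?_
  rw [hf.lab_eq hi, ← lab_congr_below (R := A) (m := m) (fun c d hd => hA c d (by omega))
    (e := .v (lam m) m) hlm le_rfl, h.lab_lam m hm hm', hS,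
    lab_top_of_mem hi (Finset.mem_insert_self _ _), lab_insert hi hp (e := .v i k) hi]
  simp

theorem IsPiece.right_unique {B A S : Finset (ℤ × ℤ)} {i k k' : ℤ} {lam rho : ℤ → ℤ}
    (h : IsPiece n B A i k k' lam rho) (ho : IsOpenSpace n B i k) (hS : S = insert (i, k) B)
    (hA : ∀ c d, d < k' → ((c, d) ∈ A ↔ (c, d) ∈ S)) {c m : ℤ} (hm : k < m) (hm' : m ≤ k')
    (hf : Follows S (.h (i - 1) k) (.v c m)) : c = rho m := by
  obtain ⟨hi, hp, ha, hb⟩ := isOpenSpace_iff.1 ho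
  have hrm : rho m ≤ n := (h.rho_lt_lam m hm hm').le.trans (h.lam_le m hm)
  have hi' : Edge.col (.h (i - 1) k) ≤ n := by simp only [Edge.col]; omega
  refine col_eq_of_lab_v_eq (n := n) (R := S) (m := m) (hf.col_le.trans hi') hrm ?_
  rw [hf.lab_eq hi', ← lab_congr_below (R := A) (m := m) (fun c d hd => hA c d (by omega))
    (e := .v (rho m) m) hrm le_rfl, h.lab_rho m hm hm', hS,
    lab_right_of_mem hi (Finset.mem_insert_self _ _), lab_insert hi hp (e := .h i k) hi]
  simp

theorem IsPiece.trace {B : Finset (ℤ × ℤ)} {i k : ℤ} {lam rho : ℤ → ℤ}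
    (h : IsPiece n B (insert (i, k) B) i k (n + 1) lam rho) (ho : IsOpenSpace n B i k) :
    Trace n i k B (insert (i, k) B) lam rho where
  lam_start := h.lam_start
  rho_start := h.rho_start
  lam_le := h.lam_le
  rho_lt_lam := h.rho_lt_lam
  lab_pos := h.lab_pos
  lab_rho_pos m hm hm' := by
    rw [h.lab_rho m hm hm']
    exact (isOpenSpace_iff.1 ho).2.2.1
  rho_step m hm hm' := by
    rw [h.rho_step m hm (by omega)]
    simp only [Finset.mem_insert, Prod.mk.injEq, hm.ne', and_false, false_or, or_self]
    split_ifs with hc <;> simp [hc]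
  lam_step m hm hm' := by
    left
    rw [h.lam_step m hm (by omega)]
    simp only [Finset.mem_insert, Prod.mk.injEq, hm.ne', and_false, false_or, or_self]
    split_ifs with hc <;> simp [hc]
  mem_below c d hd := by simp [hd.ne]
  mem_row c := Iff.rfl

/-- Above the row of its second end, moving a crossing does not affect the vertical edges. -/
theorem Good.lab_v_move {B : Finset (ℤ × ℤ)} (hB : Good n B) {i k l k' : ℤ}
    (ho : IsOpenSpace n B i k) (hq : (l, k') ∈ B) (hh : lab n B (.h l k') = lab n B (.h i k))
    (hv : lab n B (.v l k') = lab n B (.v i k)) {e m : ℤ} (he : e ≤ n) (hm : k' < m) :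
    lab n ((insert (i, k) B).erase (l, k')) (.v e m) = lab n B (.v e m) := by
  obtain ⟨hi, hp, ha, hb⟩ := isOpenSpace_iff.1 ho
  have hl := (hB _ _ hq).1
  rw [hB.lab_move hi hp hq hh hv (e := .v e m) he]
  split_ifs with hd
  -- On these antidiagonals the two interchanged strands have not risen above row `k'`.
  · refine Equiv.swap_apply_of_ne_of_ne (fun h => ?_) fun h => ?_
    · have := row_le_of_lab_eq (R := B) (e := .v e m) (e' := .h l k') he hl (h.trans hh.symm) hd.2
      simp only [Edge.row] at this
      omega
    · have := row_le_of_lab_eq (R := B) (e := .v e m) (e' := .v l k') he hl (h.trans hv.symm) hd.2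
      simp only [Edge.row] at this
      omega
  · rfl

/-- Later stages change nothing below row `k'`, and the move changes no vertical label above it.
Only the passage through row `k'` is new: the left path jumps from column `l + 1` to `i'` and the
right one from `l` to `i' - 1`, over a stretch free of open spaces. -/
theorem IsPiece.trace_glue {B A R' : Finset (ℤ × ℤ)} (hB : Good n B) {i k i' k' l : ℤ}
    {lam rho lam' rho' : ℤ → ℤ} (ho : IsOpenSpace n B i k) (hkk : k < k') (hq : (l, k') ∈ B)
    (hh : lab n B (.h l k') = lab n B (.h i k)) (hv : lab n B (.v l k') = lab n B (.v i k))
    (hAdef : A = (insert (i, k) B).erase (l, k')) (hA : Good n A)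
    (hneg : lab n A (.h l k') ≤ 0) (hi' : IsLeast {j | l < j ∧ IsOpenSpace n A j k'} i')
    (h : IsPiece n B A i k k' lam rho) (hlam : lam k' = l + 1) (hrho : rho k' = l)
    (h' : Trace n i' k' A R' lam' rho') :
    Trace n i k B R' (fun m => if m ≤ k' then lam m else lam' m)
      (fun m => if m ≤ k' then rho m else rho' m) := by
  have hkn : k' ≤ n := (hB _ _ hq).2.1
  obtain ⟨hi'n, hp', ha', hb'⟩ := isOpenSpace_iff.1 hi'.1.2
  have hli : l < i' := hi'.1.1
  have hgap := lab_h_nonpos_of_isLeast_gt hneg hi'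
  have hlow : ∀ m e, m ≤ k' → e ≤ n → lab n R' (.v e m) = lab n A (.v e m) := fun m e hm he =>
    lab_congr_below (m := m) (fun c d hd => h'.mem_below c d (by omega)) (e := .v e m) he le_rfl
  have hhigh : ∀ m e, k' < m → e ≤ n → lab n B (.v e m) = lab n A (.v e m) := fun m e hm he => by
    rw [hAdef, hB.lab_v_move ho hq hh hv he hm]
  have hmid : ∀ c m, k < m → m < k' → ((c, m) ∈ R' ↔ (c, m) ∈ B) := fun c m h1 h2 => by
    rw [h'.mem_below c m h2, hAdef]
    simp [h1.ne', h2.ne]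
  have htop : ∀ c m, k' < m → ((c, m) ∈ A ↔ (c, m) ∈ B) := fun c m h1 => by
    rw [hAdef]
    simp [h1.ne', (hkk.trans h1).ne']
  have hk1 : ¬ k' + 1 ≤ k' := by omega
  refine ⟨?_, ?_, fun m hm => ?_, fun m hm hm' => ?_, fun m hm hm' => ?_, fun m hm hm' => ?_,
    fun m hm hm' => ?_, fun m hm hm' => ?_, fun c d hd => ?_, fun c => ?_⟩
  · simp only [show k + 1 ≤ k' by omega, if_true, h.lam_start]
  · simp only [show k + 1 ≤ k' by omega, if_true, h.rho_start]
  · by_cases hmk : m ≤ k' <;> simp only [hmk, if_true, if_false]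
    · exact h.lam_le m hm
    · exact h'.lam_le m (by omega)
  · by_cases hmk : m ≤ k' <;> simp only [hmk, if_true, if_false]
    · exact h.rho_lt_lam m hm hmk
    · exact h'.rho_lt_lam m (by omega) hm'
  · by_cases hmk : m ≤ k' <;> simp only [hmk, if_true, if_false]
    · exact h.lab_pos m hm hmk
    · intro e h1 h2
      have := h'.lam_le m (by omega)
      rw [hhigh m e (by omega) (by omega)]
      exact h'.lab_pos m (by omega) hm' e h1 h2
  · by_cases hmk : m ≤ k' <;> simp only [hmk, if_true, if_false]
    · rw [hlow m _ hmk ((h.rho_lt_lam m hm hmk).le.trans (h.lam_le m hm)), h.lab_rho m hm hmk]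
      exact (isOpenSpace_iff.1 ho).2.2.1
    · exact h'.lab_rho_pos m (by omega) hm'
  · rcases lt_trichotomy m k' with hmk | rfl | hmk
    · simp only [hmk.le, show m + 1 ≤ k' by omega, if_true]
      rw [h.rho_step m hm hmk, hmid _ _ hm hmk, or_self]
      split_ifs with hc <;> simp [hc]
    · simp only [le_refl, hk1, if_true, if_false, hrho, h'.rho_start]
      exact ⟨by omega, fun _ => by omega⟩
    · simp only [show ¬ m ≤ k' by omega, show ¬ m + 1 ≤ k' by omega, if_false]
      rw [← htop _ _ hmk]
      exact h'.rho_step m hmk hm'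
  · rcases lt_trichotomy m k' with hmk | rfl | hmk
    · left
      simp only [hmk.le, show m + 1 ≤ k' by omega, if_true]
      rw [h.lam_step m hm hmk, hmid _ _ hm hmk, or_self]
      split_ifs with hc <;> simp [hc]
    · right
      simp only [le_refl, hk1, if_true, if_false, hlam, h'.lam_start]
      refine ⟨fun e h1 h2 => ?_, fun e h1 h2 => ?_, ?_⟩
      · rw [hhigh _ _ (by omega) (by omega)]
        exact hA.lab_top_nonpos (by omega) (hgap e (by omega) h2)
      · rw [hlow _ _ le_rfl (by omega)]
        rcases h2.eq_or_lt with rfl | h2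
        · exact hb'
        · exact hA.lab_bottom_nonpos (by omega) (hgap e (by omega) h2)
            (hgap (e - 1) (by omega) (by omega))
      · rw [h'.mem_row]
        exact Finset.mem_insert_self _ _
    · simp only [show ¬ m ≤ k' by omega, show ¬ m + 1 ≤ k' by omega, if_false]
      have := h'.lam_le (m + 1) (by omega)
      rw [← htop _ _ hmk]
      refine (h'.lam_step m hmk hm').imp_right fun h3 => ⟨fun e h1 h2 => ?_, h3.2⟩
      rw [hhigh _ _ (by omega) (by omega)]
      exact h3.1 e h1 h2
  · rw [h'.mem_below c d (by omega), hAdef]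
    simp [hd.ne, (hd.trans hkk).ne]
  · rw [h'.mem_below c k hkk, hAdef]
    simp [hkk.ne]

end trace

/-! ### Runs of the algorithm -/

section run

variable {n : ℤ}

/-- If two strands meeting at an open space cross elsewhere, inserting a crossing there makes them
cross twice. -/
theorem not_isRCGraph_of_cross {B : Finset (ℤ × ℤ)} (hB : Good n B) {i k l k' : ℤ}
    (ho : IsOpenSpace n B i k) (hq : (l, k') ∈ B)
    (hh : lab n B (.h l k') = lab n B (.h i k)) (hv : lab n B (.v l k') = lab n B (.v i k)) :
    CrossAt n (insert (i, k) B) (lab n B (.h i k)) (lab n B (.v i k)) (i, k) ∧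
      CrossAt n (insert (i, k) B) (lab n B (.h i k)) (lab n B (.v i k)) (l, k') ∧
      ¬ IsRCGraph n (insert (i, k) B) := by
  obtain ⟨hi, hp, ha, hb⟩ := isOpenSpace_iff.1 ho
  have hl := (hB _ _ hq).1
  have hd := hB.diag_lt_of_cross hi hp hq hh hv
  have hlab := fun {e : Edge} => lab_insert (e := e) hi hp
  have h1 : CrossAt n (insert (i, k) B) (lab n B (.h i k)) (lab n B (.v i k)) (i, k) := by
    rw [crossAt_iff, hlab (e := .h i k) hi, hlab (e := .v i k) hi]
    simp [hi]
  have h2 : CrossAt n (insert (i, k) B) (lab n B (.h i k)) (lab n B (.v i k)) (l, k') := by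
    rw [crossAt_iff, hlab (e := .h l k') hl, hlab (e := .v l k') hl]
    simp only [Edge.diag_h, Edge.diag_v, not_le.2 hd, if_false, hh, hv]
    simp [hl, hq]
  refine ⟨h1, h2, fun h => ?_⟩
  rw [h.2 _ _ (by omega) _ _ h1 h2] at hp
  exact hp hq

/-- From the open space the nonpositive strand turns right and then up, into row `k + 1`. It enters
the common crossing from below, which is no earlier than that. -/
theorem Good.row_lt_of_cross {B : Finset (ℤ × ℤ)} (hB : Good n B) {i k l k' : ℤ}
    (ho : IsOpenSpace n B i k) (hq : (l, k') ∈ B)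
    (hh : lab n B (.h l k') = lab n B (.h i k)) (hv : lab n B (.v l k') = lab n B (.v i k)) :
    k < k' := by
  obtain ⟨hi, hp, ha, hb⟩ := isOpenSpace_iff.1 ho
  have hl := (hB _ _ hq).1
  have hd := hB.diag_lt_of_cross hi hp hq hh hv
  have hru := hB.lab_right_up ho
  have h1 : Edge.col (.v (i - 1) (k + 1)) ≤ n := by simp only [Edge.col]; omega
  by_cases hd' : k - i + 1 < k' - l
  · have := row_le_of_lab_eq (R := B) (e := .v (i - 1) (k + 1)) (e' := .v l k') h1 hl
      (hru.trans hv.symm) (by simp only [Edge.diag]; omega)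
    simp only [Edge.row] at this
    omega
  · have := edge_eq_of_lab_eq (R := B) (e := .h (i - 1) k) (e' := .v l k') h1 hl
      ((lab_right_of_notMem hi hp).trans hv.symm) (by simp only [Edge.diag]; omega)
    simp at this

/-- The crossing named by a step is read in `S.graph`; undoing the interchange of labels identifies
it in the good table `B`. -/
theorem Good.cross_of_nextStage {B : Finset (ℤ × ℤ)} (hB : Good n B) {S S' : Stage}
    (ho : IsOpenSpace n B S.col S.row) (hS : S.graph = insert (S.col, S.row) B)
    (h : NextStage n S S') : ∃ l, (l, S'.row) ∈ B ∧ S.row < S'.row ∧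
      lab n B (.h l S'.row) = lab n B (.h S.col S.row) ∧
      lab n B (.v l S'.row) = lab n B (.v S.col S.row) ∧
      IsLeast {i | l < i ∧ IsOpenSpace n (S.graph.erase (l, S'.row)) i S'.row} S'.col ∧
      S'.graph = insert (S'.col, S'.row) (S.graph.erase (l, S'.row)) := by
  obtain ⟨a, b, l, h1, h2, h3, h4, h5⟩ := h
  obtain ⟨hi, hp, ha, hb⟩ := isOpenSpace_iff.1 ho
  refine ⟨l, ?_⟩
  rw [crossAt_iff, hS] at h1 h2
  obtain ⟨hmem, hl, hlabs⟩ := h2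
  have hq : (l, S'.row) ∈ B := by simpa [h3.ne'] using hmem
  have hlt := (hB _ _ hq).2.2.1
  obtain ⟨-, -, h1⟩ := h1
  rw [lab_insert hi hp (e := .h _ _) hi, lab_insert hi hp (e := .v _ _) hi] at h1
  rw [lab_insert hi hp (e := .h _ _) hl, lab_insert hi hp (e := .v _ _) hl] at hlabs
  simp only [Edge.diag_h, Edge.diag_v, le_refl, if_true] at h1 hlabs
  refine ⟨hq, h3, ?_, ?_, h4, h5⟩
  all_goals
    by_cases hd : S'.row - l ≤ S.row - S.col
    · simp only [hd, if_true] at hlabs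
      omega
    · simp only [hd, if_false, Equiv.swap_apply_eq_iff] at hlabs
      rcases h1 with ⟨rfl, rfl⟩ | ⟨rfl, rfl⟩ <;>
        simp only [Equiv.swap_apply_left, Equiv.swap_apply_right] at hlabs <;> omega

theorem Run.startRow_eq {S : Stage} {L : List Stage} {R' : Finset (ℤ × ℤ)} (h : Run n S L R') :
    startRow n L = S.row := by
  cases h <;> rfl

/-- After moving the crossing, a nonpositive strand enters its old place from the left. -/
theorem Good.lab_h_move_nonpos {B : Finset (ℤ × ℤ)} (hB : Good n B) {i k l k' : ℤ}
    (ho : IsOpenSpace n B i k) (hq : (l, k') ∈ B)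
    (hh : lab n B (.h l k') = lab n B (.h i k)) (hv : lab n B (.v l k') = lab n B (.v i k)) :
    lab n ((insert (i, k) B).erase (l, k')) (.h l k') ≤ 0 := by
  obtain ⟨hi, hp, ha, hb⟩ := isOpenSpace_iff.1 ho
  have hd := hB.diag_lt_of_cross hi hp hq hh hv
  rw [hB.lab_move hi hp hq hh hv (e := .h l k') (hB _ _ hq).1]
  simpa [hd, hh] using hb

/-- The induction keeps track of the table `B` without the newest crossing, which is good even when
`S.graph` is not an rc-graph. -/
theorem Run.exists_trace {S : Stage} {L : List Stage} {R' : Finset (ℤ × ℤ)}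
    (h : Run n S L R') : ∀ B, Good n B → IsOpenSpace n B S.col S.row → S.row ≤ n →
      S.graph = insert (S.col, S.row) B → Good n R' ∧ ∃ lam rho,
        Trace n S.col S.row B R' lam rho ∧
        (∀ c m, LeftPath n L c m → S.row < m ∧ m ≤ n + 1 ∧ c = lam m) ∧
        (∀ c m, RightPath n L c m → S.row < m ∧ m ≤ n + 1 ∧ c = rho m) := by
  induction h with
  | halt S hrc =>
    intro B hB ho hk hS
    have hno : ∀ j m, (j, m) ∈ B → lab n B (.h j m) = lab n B (.h S.col S.row) →
        lab n B (.v j m) ≠ lab n B (.v S.col S.row) := fun j m h1 h2 h3 =>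
      (not_isRCGraph_of_cross hB ho h1 h2 h3).2.2 (hS ▸ hrc)
    obtain ⟨lam, rho, hpc⟩ := hB.exists_piece_insert hk ho hno
    refine ⟨hS ▸ hB.insert_openSpace hk ho hno, lam, rho, hS ▸ hpc.trace ho, ?_, ?_⟩
    · rintro c m (⟨h1, h2, h3⟩ | h)
      · exact ⟨h1, h2, hpc.left_unique ho hS (fun c d _ => by rw [hS]) h1 h2 h3⟩
      · exact h.elim
    · rintro c m (⟨h1, h2, h3⟩ | h)
      · exact ⟨h1, h2, hpc.right_unique ho hS (fun c d _ => by rw [hS]) h1 h2 h3⟩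
      · exact h.elim
  | step S S' L R' hrc hstep hrun ih =>
    intro B hB ho hk hS
    obtain ⟨l, hq, hkk, hh, hv, hleast, hS'⟩ := hB.cross_of_nextStage ho hS hstep
    have hkn := (hB _ _ hq).2.1
    have hA := hB.move hk ho hq hh hv
    have hneg := hB.lab_h_move_nonpos ho hq hh hv
    obtain ⟨lam, rho, hpc, hlam, hrho⟩ := hB.exists_piece_move hk ho hkk hq hh hv
    rw [← hS] at hA hpc hneg
    obtain ⟨hR', lam', rho', htr, hleft, hright⟩ := ih _ hA hleast.1.2 hkn hS'
    have hcells : ∀ c d, d < S'.row →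
        ((c, d) ∈ S.graph.erase (l, S'.row) ↔ (c, d) ∈ S.graph) := fun c d hd => by
      simp [hd.ne]
    have hrow := hrun.startRow_eq
    refine ⟨hR', _, _, hpc.trace_glue hB ho hkk hq hh hv (by rw [hS]) hA hneg hleast hlam hrho
      htr, ?_, ?_⟩
    · rintro c m (⟨h1, h2, h3⟩ | h)
      · rw [hrow] at h2
        rw [if_pos h2]
        exact ⟨h1, by omega, hpc.left_unique ho hS hcells h1 h2 h3⟩
      · obtain ⟨h1, h2, h3⟩ := hleft c m h
        rw [if_neg (by omega)]
        exact ⟨by omega, h2, h3⟩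
    · rintro c m (⟨h1, h2, h3⟩ | h)
      · rw [hrow] at h2
        rw [if_pos h2]
        exact ⟨h1, by omega, hpc.right_unique ho hS hcells h1 h2 h3⟩
      · obtain ⟨h1, h2, h3⟩ := hright c m h
        rw [if_neg (by omega)]
        exact ⟨by omega, h2, h3⟩

/-- Induction on the number of rows above the inserted crossing; in the top row no higher crossing
is available, so the run halts. -/
theorem Good.exists_run (N : ℕ) : ∀ (B : Finset (ℤ × ℤ)) (S : Stage), Good n B →
    IsOpenSpace n B S.col S.row → 0 < S.row → S.row ≤ n → n - S.row ≤ N →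
    S.graph = insert (S.col, S.row) B → ∃ L R', Run n S L R' := by
  induction N with
  | zero =>
    intro B S hB ho h0 hk hN hS
    refine ⟨_, _, Run.halt S (hS ▸ (hB.insert_openSpace hk ho ?_).isRCGraph)⟩
    intro j m h1 h2 h3
    have := hB.row_lt_of_cross ho h1 h2 h3
    have := (hB _ _ h1).2.1
    push_cast at hN
    omega
  | succ N ih =>
    intro B S hB ho h0 hk hN hS
    by_cases hex : ∃ l k', (l, k') ∈ B ∧ lab n B (.h l k') = lab n B (.h S.col S.row) ∧
      lab n B (.v l k') = lab n B (.v S.col S.row)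
    · obtain ⟨l, k', hq, hh, hv⟩ := hex
      have hkk := hB.row_lt_of_cross ho hq hh hv
      obtain ⟨hc, hc', hrc⟩ := not_isRCGraph_of_cross hB ho hq hh hv
      have hA := hB.move hk ho hq hh hv
      obtain ⟨i', hi'⟩ := exists_isLeast_openSpace (hB _ _ hq).1 (by omega)
        (hB.lab_h_move_nonpos ho hq hh hv)
      have hkn := (hB _ _ hq).2.1
      obtain ⟨L, R', hrun⟩ := ih _ ⟨insert (i', k') ((insert (S.col, S.row) B).erase (l, k')), i',
        k'⟩ hA hi'.1.2 (by omega : 0 < k') hkn (by push_cast at hN; simp only; omega) rfl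
      rw [← hS] at hc hc' hrc hi' hrun
      exact ⟨_, _, Run.step S _ L R' hrc ⟨_, _, l, hc, hc', hkk, hi', rfl⟩ hrun⟩
    · refine ⟨_, _, Run.halt S (hS ▸ (hB.insert_openSpace hk ho ?_).isRCGraph)⟩
      exact fun j m h1 h2 h3 => hex ⟨j, m, h1, h2, h3⟩

theorem Good.exists_inserts {R : Finset (ℤ × ℤ)} (hR : Good n R) {x : ℤ} (hx : 1 ≤ x)
    (hxn : x ≤ n) : ∃ L R', Inserts n R x L R' := by
  obtain ⟨i, hi⟩ := exists_isLeast_openSpace_row (n := n) R (k := x) (by omega)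
  obtain ⟨L, R', h⟩ := Good.exists_run (n - x).toNat R ⟨insert (i, x) R, i, x⟩ hR hi.1
    (by simp only; omega) hxn (Int.self_le_toNat _) rfl
  exact ⟨L, R', _, ⟨rfl, hi, rfl⟩, h⟩

/-- The trace of an insertion, and the signs of the vertical edges near its start. -/
theorem Inserts.exists_trace {R R' : Finset (ℤ × ℤ)} {x : ℤ} {L : List Stage}
    (h : Inserts n R x L R') (hR : Good n R) (hxn : x ≤ n) : Good n R' ∧ ∃ i lam rho,
      Trace n i x R R' lam rho ∧
      (∀ e < i, lab n R (.v e (x + 1)) ≤ 0) ∧ (∀ e ≤ i, lab n R' (.v e x) ≤ 0) ∧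
      (∀ c m, LeftPath n L c m → x < m ∧ m ≤ n + 1 ∧ c = lam m) ∧
      (∀ c m, RightPath n L c m → x < m ∧ m ≤ n + 1 ∧ c = rho m) := by
  obtain ⟨S, ⟨rfl, hi, hS⟩, hrun⟩ := h
  obtain ⟨hR', lam, rho, htr, hl, hr⟩ := hrun.exists_trace R hR hi.1 hxn hS
  obtain ⟨hin, -, -, hb⟩ := isOpenSpace_iff.1 hi.1
  have hgap := lab_h_nonpos_of_isLeast hi
  refine ⟨hR', S.col, lam, rho, htr, fun e he => ?_, fun e he => ?_, hl, hr⟩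
  · exact hR.lab_top_nonpos (by omega) (hgap e he)
  · rw [lab_congr_below (m := S.row) (fun c d hd => htr.mem_below c d hd) (e := .v e S.row)
      (he.trans hin) le_rfl]
    rcases he.eq_or_lt with rfl | he
    · exact hb
    · exact hR.lab_bottom_nonpos (by omega) (hgap e he) (hgap (e - 1) (by omega))

/-! ### Comparison of two successive insertions -/

/-- Where the paths touch, a crossing of `R₁` keeps `rho` from moving right, and any other cell
moves `lam'` right. At the start and at jumps, `lam'` passes only edges that are nonpositive in
`R₁`, so it cannot pass `rho`, which is positive there. -/
theorem Trace.lam_le_rho {R R₁ R₂ : Finset (ℤ × ℤ)} {i j x y : ℤ} {lam rho lam' rho' : ℤ → ℤ}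
    (h : Trace n i x R R₁ lam rho) (h' : Trace n j y R₁ R₂ lam' rho')
    (hstart : ∀ e < j, lab n R₁ (.v e (y + 1)) ≤ 0) (hxy : x ≤ y) (m : ℤ) (hm : y < m)
    (hmn : m ≤ n + 1) : lam' m ≤ rho m := by
  have hm : y + 1 ≤ m := hm
  induction m, hm using Int.leInduction with
  | base =>
    by_contra hlt
    have h1 := h.lab_rho_pos (y + 1) (by omega) hmn
    have h2 := hstart (rho (y + 1)) (by rw [h'.lam_start] at hlt; omega)
    omega
  | succ m hm ih =>
    have hle := ih (by omega) (by omega)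
    obtain ⟨r1, r2⟩ := h.rho_step m (by omega) (by omega)
    rcases h'.lam_step m (by omega) (by omega) with ⟨l1, l2⟩ | ⟨l1, -⟩
    · rcases hle.eq_or_lt with heq | hlt
      · by_cases hc : (rho m, m) ∈ R₁
        · have := r2 (Or.inr hc)
          omega
        · have := l2 (Or.inl (heq ▸ hc))
          omega
      · omega
    · by_contra hlt
      have h1 := h.lab_rho_pos (m + 1) (by omega) hmn
      have h2 := l1 (rho (m + 1)) (by omega) (by omega)
      omega

/-- At its start and at its jumps leftwards, the first left path passes nonpositive edges of `R₁`
and lands at a crossing of `R₁`. The strip between the second insertion's paths has only positive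
edges, so all this happens to its right; afterwards the step rules keep the order. -/
theorem Trace.lam_le_rho_of_lt {R R₁ R₂ : Finset (ℤ × ℤ)} {i j x y : ℤ}
    {lam rho lam' rho' : ℤ → ℤ} (h : Trace n i x R R₁ lam rho) (h' : Trace n j y R₁ R₂ lam' rho')
    (hstart : ∀ e ≤ i, lab n R₁ (.v e x) ≤ 0) (hyx : y < x) (m : ℤ) (hm : x < m)
    (hmn : m ≤ n + 1) : lam m ≤ rho' m := by
  -- a row in which the first insertion adds a crossing
  have key : ∀ m, y < m → m ≤ n → (lam (m + 1), m) ∈ R₁ → lab n R₁ (.v (lam (m + 1)) m) ≤ 0 →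
      lam (m + 1) < lam' m → lam (m + 1) ≤ rho' (m + 1) := by
    intro m h1 h2 h3 h4 h5
    obtain ⟨r1, r2⟩ := h'.rho_step m h1 h2
    have h6 : lam (m + 1) ≤ rho' m := by
      by_contra h6
      have := h'.lab_pos m h1 (by omega) (lam (m + 1)) (by omega) (by omega)
      omega
    -- In the same column, the crossing in `R₁` keeps `rho'` from moving right; otherwise there is
    -- room for its shift by at most one column.
    rcases h6.eq_or_lt with h6 | h6
    · rw [h6] at h3
      have := r2 (Or.inl h3)
      omega
    · omega
  have hm : x + 1 ≤ m := hm
  induction m, hm using Int.leInduction with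
  | base =>
    have h1 := h'.lab_pos x hyx (by omega) _ (h'.rho_lt_lam x hyx (by omega)) le_rfl
    have h2 := hstart (lam' x)
    refine key x hyx (by omega) ?_ (hstart _ h.lam_start.le) ?_
    · rw [h.mem_row, h.lam_start]
      exact Finset.mem_insert_self _ _
    · rw [h.lam_start]
      omega
  | succ m hm ih =>
    have hle := ih (by omega) (by omega)
    obtain ⟨r1, r2⟩ := h'.rho_step m (by omega) (by omega)
    rcases h.lam_step m (by omega) (by omega) with ⟨l1, l2⟩ | ⟨-, l2, l3⟩
    · rcases hle.eq_or_lt with heq | hlt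
      · by_cases hc : (lam m, m) ∈ R₁
        · have := r2 (Or.inl (heq ▸ hc))
          omega
        · have := l2 (Or.inr hc)
          omega
      · omega
    · by_cases hup : lam m ≤ lam (m + 1)
      · have h1 := h'.rho_lt_lam m (by omega) (by omega)
        have h2 := h'.lab_pos m (by omega) (by omega) _ h1 le_rfl
        have h3 := l2 (lam' m) (by omega)
        exact key m (by omega) (by omega) l3 (l2 _ hup le_rfl) (by omega)
      · omega

end run

end RCGraph
theorem lemma3p2 (n : ℤ) (R : Finset (ℤ × ℤ)) (hR : RCGraph.IsRCGraph n R)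
    (hpos : RCGraph.NoNonposCrossing n R)
    (x y : ℤ) (hx : 1 ≤ x) (hxn : x ≤ n) (hy : 1 ≤ y) (hyn : y ≤ n) :
    (∃ (P Q : List RCGraph.Stage) (R₁ R₂ : Finset (ℤ × ℤ)),
      RCGraph.Inserts n R x P R₁ ∧ RCGraph.Inserts n R₁ y Q R₂) ∧
    ∀ (P Q : List RCGraph.Stage) (R₁ R₂ : Finset (ℤ × ℤ)),
      RCGraph.Inserts n R x P R₁ → RCGraph.Inserts n R₁ y Q R₂ →
      (x ≤ y → RCGraph.WeaklyLeft (RCGraph.RightPath n P) (RCGraph.LeftPath n Q)) ∧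
      (y < x → RCGraph.WeaklyLeft (RCGraph.RightPath n Q) (RCGraph.LeftPath n P)) := by
  have hG := hR.good hpos
  refine ⟨?_, fun P Q R₁ R₂ hP hQ => ?_⟩
  · obtain ⟨P, R₁, hP⟩ := hG.exists_inserts hx hxn
    obtain ⟨Q, R₂, hQ⟩ := (hP.exists_trace hG hxn).1.exists_inserts hy hyn
    exact ⟨P, Q, R₁, R₂, hP, hQ⟩
  · obtain ⟨hG₁, i, lam, rho, ht, -, hs, hl, hr⟩ := hP.exists_trace hG hxn
    obtain ⟨-, j, lam', rho', ht', hs', -, hl', hr'⟩ := hQ.exists_trace hG₁ hyn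
    refine ⟨fun hxy m c d hc hd => ?_, fun hyx m c d hc hd => ?_⟩
    · obtain ⟨-, -, rfl⟩ := hr c m hc
      obtain ⟨h1, h2, rfl⟩ := hl' d m hd
      exact ht.lam_le_rho ht' hs' hxy m h1 h2
    · obtain ⟨-, -, rfl⟩ := hr' c m hc
      obtain ⟨h1, h2, rfl⟩ := hl d m hd
      exact ht.lam_le_rho_of_lt ht' hs hyx m h1 h2
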